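/- A (non-negative) weighted automaton $\mathcal W=\langle Q,\Sigma,M,F\rangle$ over $(\mathbb Q,+,\times)$ consists of a finite set $Q$ of states, a finite alphabet $\Sigma$, matrices $M(a)\in\mathbb Q_{\ge 0}^{Q\times Q}$ for $a\in\Sigma$, and a set $F\subseteq Q$ of final states; it is given with each weight written as a numerator and a denominator in binary, and its size is the number of bits of this description. For $s\in Q$ and a word $w=a_1\cdots a_n\in\Sigma^*$ let $\nu_s(w)=\sum_{t\in F}\bigl(M(a_1)\cdots M(a_n)\bigr)_{s,t}$. A state $s$ is big-O of a state $s'$ if there is $C>0$ with $\nu_s(w)\le C\,\nu_{s'}(w)$ for all $w\in\Sigma^*$. The automaton is unambiguous from $s$ if for every word $w=a_1\cdots a_n$ there is at most one accepting path from $s$, i.e. at most one sequence of states $s=q_0,q_1,\dots,q_n\in F$ with $M(a_i)(q_{i-1},q_i)>0$ for all $i$. Theorem. The following problem is decidable in (deterministic) polynomial time: given a non-negative weighted automaton $\mathcal W$ and states $s,s'$ such that $\mathcal W$ is unambiguous from $s$ and unambiguous from $s'$, is $s$ big-O of $s'$? That is, there is a single Turing machine which, on every such input $(\mathcal W,s,s')$,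 halts with the correct answer within a number of steps bounded by a fixed polynomial in the size of the input. -/

import Mathlib

/-- A weighted automaton with states `Q` and alphabet `S` over the semiring `(ℚ, +, ×)`, with
non-negative weights: `weight a q q'` is the weight of the transition from `q` to `q'` reading
`a` (weight `0` means that there is no such transition). -/
structure WeightedAutomaton (Q S : Type) where
  weight : S → Matrix Q Q ℚ
  weight_nonneg : ∀ a q q', 0 ≤ weight a q q'
  final : Finset Q

namespace WeightedAutomaton

variable {Q S : Type}

/-- The weight `ν_s(w) = ∑_{t ∈ F} (M(a₁) ⋯ M(aₙ))_{s,t}` of the word `w = a₁ ⋯ aₙ` from the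
state `s`. -/
def wordWeight [Fintype Q] [DecidableEq Q] (A : WeightedAutomaton Q S) (s : Q) (w : List S) : ℚ :=
  ∑ t ∈ A.final, (w.map A.weight).prod s t

/-- `s` is big-O of `s'`: for some constant `C > 0`, every word `w` satisfies
`ν_s(w) ≤ C · ν_{s'}(w)`. -/
def IsBigO [Fintype Q] [DecidableEq Q] (A : WeightedAutomaton Q S) (s s' : Q) : Prop :=
  ∃ C : ℝ, 0 < C ∧ ∀ w : List S, (A.wordWeight s w : ℝ) ≤ C * (A.wordWeight s' w : ℝ)

/-- The nondeterministic finite automaton with the same states and final states, start state `s`,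
and a transition wherever the weight is positive. -/
def toNFA (A : WeightedAutomaton Q S) (s : Q) : NFA S Q where
  step q a := {q' | 0 < A.weight a q q'}
  start := {s}
  accept := {t | t ∈ A.final}

/-- The accepting paths of `A.toNFA s` on the word `w`: the paths labelled `w` that lead from `s`
to some final state. -/
def AcceptingPath (A : WeightedAutomaton Q S) (s : Q) (w : List S) : Type :=
  Σ t : {t : Q // t ∈ (A.toNFA s).accept}, (A.toNFA s).Path s t.1 w

/-- `A` is unambiguous from `s`: every word has at most one accepting path from `s`. -/
def UnambiguousFrom (A : WeightedAutomaton Q S) (s : Q) : Prop :=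
  ∀ w : List S, Subsingleton (A.AcceptingPath s w)

end WeightedAutomaton

/-- A concrete input of the big-O problem: a weighted automaton with states `0, …, numStates - 1`
and letters `0, …, numLetters - 1`, each of whose weights is given as a numerator and a
denominator (not necessarily in lowest terms), and two states `s`, `s'`. -/
structure BigOInput where
  numStates : ℕ
  numLetters : ℕ
  num : Fin numLetters → Fin numStates → Fin numStates → ℕ
  den : Fin numLetters → Fin numStates → Fin numStates → ℕ
  den_pos : ∀ a q q', 0 < den a q q'
  final : Finset (Fin numStates)
  s : Fin numStates
  s' : Fin numStates

namespace BigOInput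

open Computability (Γ' encodeNat)

/-- The weighted automaton that the input describes. -/
def automaton (I : BigOInput) : WeightedAutomaton (Fin I.numStates) (Fin I.numLetters) where
  weight a q q' := (I.num a q q' : ℚ) / (I.den a q q' : ℚ)
  weight_nonneg _ _ _ := div_nonneg (Nat.cast_nonneg _) (Nat.cast_nonneg _)
  final := I.final

/-- A natural number in binary, followed by a separator. -/
def encodeBinary (k : ℕ) : List Γ' :=
  (encodeNat k).map Γ'.bit ++ [Γ'.comma]

/-- A natural number in unary, followed by a separator. -/
def encodeUnary (k : ℕ) : List Γ' :=
  List.replicate k (Γ'.bit true) ++ [Γ'.comma]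

/-- The input as a string: the number of states, the number of letters, `s` and `s'`, one bit per
state telling whether it is final, and then the entries of all transition matrices, letter by
letter and row by row, each as numerator and denominator in binary. Names and numbers of states
and letters are in unary; as every state contributes a bit and every letter a full matrix, this
changes the length of the string by a constant factor only. -/
def encode (I : BigOInput) : List Γ' :=
  encodeUnary I.numStates ++ encodeUnary I.numLetters ++ encodeUnary I.s ++ encodeUnary I.s' ++
  (List.finRange I.numStates).map (fun q => Γ'.bit (decide (q ∈ I.final))) ++
  (List.finRange I.numLetters).flatMap fun a =>
    (List.finRange I.numStates).flatMap fun q =>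
      (List.finRange I.numStates).flatMap fun q' =>
        encodeBinary (I.num a q q') ++ encodeBinary (I.den a q q')

end BigOInput

/-- Polynomial-time decidability of the problem `p` on the inputs satisfying `promise`, where
inputs are presented as strings through `enc`: there is one (multi-stack) Turing machine which, on
every input `x` with `promise x`, halts within a number of steps polynomial in the length of
`enc x`, with output `true` if `p x` holds and `false` otherwise. Nothing is required on other
inputs. All stack alphabets of the machine are finite. -/
def DecidableInPolyTimeOn {α Γ : Type} (enc : α → List Γ) (promise p : α → Prop) : Prop :=
  ∃ f : {x : α // promise x} → Bool, (∀ x, f x = true ↔ p x.1) ∧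
    ∃ c : Turing.TM2ComputableInPolyTime (fun x : {x : α // promise x} => enc x.1)
      Computability.encodeBool f, ∀ k, Finite (c.tm.Γ k)

/-!
The proof has a mathematical half, a criterion for big-O that involves only finitely many numbers of
polynomial length, and a half on Turing machines, which shows that the criterion can be tested in
polynomial time.

Consider the product automaton, whose vertices are the pairs of states and whose edges are the pairs
of transitions with the same letter and positive weights, weighted by the quotient of the two
weights. If `W` is unambiguous from `s` and from `s'`, then the accepting paths from `(s, s')`
correspond to the words accepted from both states, and the weight of such a path is
`ν_s(w) / ν_{s'}(w)`. So `s` is big-O of `s'` if and only if every word accepted from `s` is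
accepted from `s'`, and the weights of the accepting paths from `(s, s')` are bounded
(`WeightedAutomaton.isBigO_iff`). Let `N` be the number of pairs of states.

* Inclusion of the supports is a matter of counting (`WeightedAutomaton.support_subset_iff`). By
  unambiguity, the number of accepting paths from `(s, s')` of a given length is the number of
  words accepted from both states, and that from `(s, s)` is the number of words accepted from
  `s`. Both sequences satisfy the linear recurrence given by the characteristic polynomial of the
  adjacency matrix, so they agree if they agree for all lengths up to `N`.
* Let `d n v` be the maximal weight of an accepting path of length at most `n` from the vertex `v`.
  The weights of accepting paths are bounded at all reachable vertices if and only if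
  `d (N + 1) v ≤ d N v` for all reachable `v`. If there is no growth in one step then there is none
  later (`IsMaxWeight.le_of_stable`), and bounded suprema are attained by paths of length at most
  `N` (`IsMaxWeight.stable`). Reachability, too, is a matter of counting paths.

The numbers of paths and the maximal weights `d n v` satisfy recursions in `n` of the same shape. As
the maximum of fractions is one of them, their numerators and denominators are products of at most
`n` factors of polynomial length; they stay short although fractions are never reduced.

The Turing machine is obtained in two stages. A structured program on four binary stacks is compiled
to a multi-stack machine that simulates it step by step (`PolyTime.Run.steps`). The programs
operate on binary trees in Polish notation, and `PolyTime.PTime f` says that a program replaces the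
tree for `a` on top of a stack by the tree for `f a`, in polynomial time and with a result of
polynomial size. This class of functions is closed under composition, pairing, case distinction, and
folds over lists with intermediate results of polynomial size (`PolyTime.PTime.foldl`); list
functions, binary arithmetic, the parser and the tables of path sums (`PolyTime.PTime.table`) are
all built from these.
-/

open Computability (Γ')

namespace PolyTime

/-! ### Structured programs on four binary stacks -/

/-- The four binary stacks: `main` holds the data, the other ones are workspace. -/
inductive Reg
  | main | a | b | cnt
  deriving DecidableEq

instance : Fintype Reg := ⟨{.main, .a, .b, .cnt}, fun r => by cases r <;> simp⟩

/-- Structured programs on the stacks `Reg`. -/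
inductive Prog
  | skip
  | push (r : Reg) (x : Bool)
  | pop (r : Reg)
  | seq (p q : Prog)
  /-- Branch on a test of the top symbol of the stack `r`. -/
  | ite (r : Reg) (t : Option Bool → Bool) (p q : Prog)
  /-- Repeat as long as the top symbol of the stack `r` passes the test. -/
  | loop (r : Reg) (t : Option Bool → Bool) (p : Prog)

/-- `Run p S S' n`: started with stack contents `S`, the program `p` terminates with stack contents
`S'` within `n` steps. -/
inductive Run : Prog → (Reg → List Bool) → (Reg → List Bool) → ℕ → Prop
  | skip (S) : Run .skip S S 1
  | push (S r x) : Run (.push r x) S (Function.update S r (x :: S r)) 1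
  | pop (S r) : Run (.pop r) S (Function.update S r (S r).tail) 1
  | seq {p q S S' S'' n n'} : Run p S S' n → Run q S' S'' n' → Run (.seq p q) S S'' (n + n')
  | ite_true {r t p q S S' n} : t (S r).head? = true → Run p S S' n →
      Run (.ite r t p q) S S' (n + 1)
  | ite_false {r t p q S S' n} : t (S r).head? = false → Run q S S' n →
      Run (.ite r t p q) S S' (n + 1)
  | loop_false {r t p S} : t (S r).head? = false → Run (.loop r t p) S S 1
  | loop_true {r t p S S' S'' n n'} : t (S r).head? = true → Run p S S' n →
      Run (.loop r t p) S' S'' n' → Run (.loop r t p) S S'' (n + n' + 1)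
  | mono {p S S' n n'} : Run p S S' n → n ≤ n' → Run p S S' n'

/-! ### Compilation to multi-stack Turing machines -/

/-- The stacks of the machine: input, output and the working stacks. -/
inductive Stack
  | inp | out | reg (r : Reg)
  deriving DecidableEq, Fintype

/-- The stack alphabets of the machine. -/
abbrev Stack.Alphabet : Stack → Type
  | .inp => Γ'
  | .out => Bool
  | .reg _ => Bool

/-- The labels that the compiled program uses. -/
def Lab : Prog → Type
  | .skip => Unit
  | .push _ _ => Unit
  | .pop _ => Unit
  | .seq p q => Lab p ⊕ Lab q
  | .ite _ _ p q => Option (Lab p ⊕ Lab q)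
  | .loop _ _ p => Option (Lab p)

instance Lab.fintype : (p : Prog) → Fintype (Lab p)
  | .skip => inferInstanceAs (Fintype Unit)
  | .push _ _ => inferInstanceAs (Fintype Unit)
  | .pop _ => inferInstanceAs (Fintype Unit)
  | .seq p q =>
    have := Lab.fintype p
    have := Lab.fintype q
    inferInstanceAs (Fintype (Lab p ⊕ Lab q))
  | .ite _ _ p q =>
    have := Lab.fintype p
    have := Lab.fintype q
    inferInstanceAs (Fintype (Option (Lab p ⊕ Lab q)))
  | .loop _ _ p =>
    have := Lab.fintype p
    inferInstanceAs (Fintype (Option (Lab p)))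

/-- The label at which the compiled program starts. -/
def Lab.entry : (p : Prog) → Lab p
  | .skip => ()
  | .push _ _ => ()
  | .pop _ => ()
  | .seq p _ => Sum.inl (Lab.entry p)
  | .ite _ _ _ _ => none
  | .loop _ _ _ => none

/-- The compiled program: its labels are embedded by `e` into the labels of the whole machine, and
it leaves through the label `ex`. The internal state remembers the outcome of a test as
`isSome`. -/
def compile {L : Type} : (p : Prog) → (Lab p → L) → L → Lab p →
    Turing.TM2.Stmt Stack.Alphabet L (Option Γ')
  | .skip, _, ex, _ => .goto fun _ => ex
  | .push r x, _, ex, _ => .push (.reg r) (fun _ => x) (.goto fun _ => ex)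
  | .pop r, _, ex, _ => .pop (.reg r) (fun v _ => v) (.goto fun _ => ex)
  | .seq p q, e, _, .inl l => compile p (e ∘ Sum.inl) (e (Sum.inr (Lab.entry q))) l
  | .seq _ q, e, ex, .inr l => compile q (e ∘ Sum.inr) ex l
  | .ite r t p q, e, _, none =>
      .peek (.reg r) (fun _ o => if t o then some Γ'.blank else none)
        (.branch Option.isSome (.goto fun _ => e (some (Sum.inl (Lab.entry p))))
          (.goto fun _ => e (some (Sum.inr (Lab.entry q)))))
  | .ite _ _ p _, e, ex, some (.inl l) => compile p (e ∘ some ∘ Sum.inl) ex l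
  | .ite _ _ _ q, e, ex, some (.inr l) => compile q (e ∘ some ∘ Sum.inr) ex l
  | .loop r t p, e, ex, none =>
      .peek (.reg r) (fun _ o => if t o then some Γ'.blank else none)
        (.branch Option.isSome (.goto fun _ => e (some (Lab.entry p))) (.goto fun _ => ex))
  | .loop _ _ p, e, _, some l => compile p (e ∘ some) (e none) l

/-- The contents of all stacks of the machine. -/
def contents (i : List Γ') (o : List Bool) (S : Reg → List Bool) : (k : Stack) → List k.Alphabet
  | .inp => i
  | .out => o
  | .reg r => S r

@[simp] theorem contents_reg (i : List Γ') (o : List Bool) (S : Reg → List Bool) (r : Reg) :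
    contents i o S (.reg r) = S r := rfl

theorem update_contents_reg (i : List Γ') (o : List Bool) (S : Reg → List Bool) (r : Reg)
    (l : List Bool) :
    Function.update (contents i o S) (.reg r) l = contents i o (Function.update S r l) := by
  funext k
  rcases k with _ | _ | k
  · simp [contents]
  · simp [contents]
  · by_cases h : k = r
    · subst h; simp
    · simp [contents, h]

/-- `Steps M n c c'`: the machine `M` gets from `c` to `c'` in at most `n` steps. -/
def Steps {K L σ : Type} [DecidableEq K] {G : K → Type} (M : L → Turing.TM2.Stmt G L σ) (n : ℕ)
    (c c' : Turing.TM2.Cfg G L σ) : Prop :=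
  ∃ m ≤ n, (flip bind (Turing.TM2.step M))^[m] (some c) = some c'

namespace Steps

variable {K L σ : Type} [DecidableEq K] {G : K → Type} {M : L → Turing.TM2.Stmt G L σ}

theorem trans {n n' : ℕ} {c c' c'' : Turing.TM2.Cfg G L σ} (h : Steps M n c c')
    (h' : Steps M n' c' c'') : Steps M (n + n') c c'' := by
  obtain ⟨m, hm, e⟩ := h
  obtain ⟨m', hm', e'⟩ := h'
  exact ⟨m' + m, by omega, by rw [Function.iterate_add_apply, e, e']⟩

theorem mono {n n' : ℕ} {c c' : Turing.TM2.Cfg G L σ} (h : Steps M n c c') (hn : n ≤ n') :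
    Steps M n' c c' := by
  obtain ⟨m, hm, e⟩ := h
  exact ⟨m, hm.trans hn, e⟩

theorem single {l : L} {v : σ} {S : ∀ k, List (G k)} {c : Turing.TM2.Cfg G L σ}
    (h : Turing.TM2.stepAux (M l) v S = c) : Steps M 1 ⟨some l, v, S⟩ c :=
  ⟨1, le_rfl, by simpa [flip] using h⟩

end Steps

/-- The compiled program simulates the structured one step by step. -/
theorem Run.steps {L : Type} {M : L → Turing.TM2.Stmt Stack.Alphabet L (Option Γ')}
    {p : Prog} {S S' : Reg → List Bool} {n : ℕ} (h : Run p S S' n) (i : List Γ') (o : List Bool) :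
    ∀ (e : Lab p → L) (ex : L), (∀ l, M (e l) = compile p e ex l) → ∀ v, ∃ v',
      Steps M n ⟨some (e (Lab.entry p)), v, contents i o S⟩ ⟨some ex, v', contents i o S'⟩ := by
  induction h with
  | skip S =>
    intro e ex hM v
    exact ⟨v, Steps.single (by rw [hM]; simp [compile])⟩
  | push S r x =>
    intro e ex hM v
    exact ⟨v, Steps.single (by rw [hM]; simp [compile, update_contents_reg])⟩
  | pop S r =>
    intro e ex hM v
    exact ⟨v, Steps.single (by rw [hM]; simp [compile, update_contents_reg])⟩
  | seq h₁ h₂ ih₁ ih₂ =>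
    intro e ex hM v
    obtain ⟨v₁, s₁⟩ := ih₁ (e ∘ Sum.inl) _ (fun l => hM (Sum.inl l)) v
    obtain ⟨v₂, s₂⟩ := ih₂ (e ∘ Sum.inr) ex (fun l => hM (Sum.inr l)) v₁
    exact ⟨v₂, s₁.trans s₂⟩
  | @ite_true r t p q S S' n ht h ih =>
    intro e ex hM v
    obtain ⟨v₁, s₁⟩ := ih (e ∘ some ∘ Sum.inl) ex (fun l => hM (some (Sum.inl l))) (some Γ'.blank)
    refine ⟨v₁, (Steps.trans (Steps.single ?_) s₁).mono (by omega)⟩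
    have := hM none
    rw [show Lab.entry (.ite r t p q) = none from rfl, this]
    simp [compile, ht]
    rfl
  | @ite_false r t p q S S' n ht h ih =>
    intro e ex hM v
    obtain ⟨v₁, s₁⟩ := ih (e ∘ some ∘ Sum.inr) ex (fun l => hM (some (Sum.inr l))) none
    refine ⟨v₁, (Steps.trans (Steps.single ?_) s₁).mono (by omega)⟩
    have := hM none
    rw [show Lab.entry (.ite r t p q) = none from rfl, this]
    simp [compile, ht]
    rfl
  | @loop_false r t p S ht =>
    intro e ex hM v
    refine ⟨none, Steps.single ?_⟩
    have := hM none
    rw [show Lab.entry (.loop r t p) = none from rfl, this]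
    simp [compile, ht]
  | @loop_true r t p S S' S'' n n' ht h₁ h₂ ih₁ ih₂ =>
    intro e ex hM v
    obtain ⟨v₁, s₁⟩ := ih₁ (e ∘ some) (e none) (fun l => hM (some l)) (some Γ'.blank)
    obtain ⟨v₂, s₂⟩ := ih₂ e ex hM v₁
    refine ⟨v₂, (Steps.trans (Steps.single ?_) (s₁.trans s₂)).mono (by omega)⟩
    have := hM none
    rw [show Lab.entry (.loop r t p) = none from rfl, this]
    simp [compile, ht]
    rfl
  | mono h hn ih =>
    intro e ex hM v
    obtain ⟨v₁, s₁⟩ := ih e ex hM v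
    exact ⟨v₁, s₁.mono hn⟩

/-! ### Binary trees as universal data -/

/-- The universal data type of the machine: binary trees, as in Lisp. -/
inductive D
  | nil
  | cons (x y : D)

/-- A tree as a string of bits in Polish notation. -/
def D.enc : D → List Bool
  | .nil => [false]
  | .cons x y => true :: (x.enc ++ y.enc)

/-- The length of the encoding of a tree. -/
def D.size (d : D) : ℕ := d.enc.length

@[simp] theorem D.size_nil : D.nil.size = 1 := rfl

@[simp] theorem D.size_cons (x y : D) : (D.cons x y).size = x.size + y.size + 1 := by
  simp [D.size, D.enc]

theorem D.size_pos (d : D) : 0 < d.size := by cases d <;> simp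

/-- Stack contents given stack by stack. -/
def stk (m a b c : List Bool) : Reg → List Bool
  | .main => m
  | .a => a
  | .b => b
  | .cnt => c

section stk

variable (m a b c l : List Bool)

@[simp] theorem stk_main : stk m a b c .main = m := rfl
@[simp] theorem stk_a : stk m a b c .a = a := rfl
@[simp] theorem stk_b : stk m a b c .b = b := rfl
@[simp] theorem stk_cnt : stk m a b c .cnt = c := rfl

@[simp] theorem update_stk_main : Function.update (stk m a b c) .main l = stk l a b c := by
  funext r; cases r <;> rfl
@[simp] theorem update_stk_a : Function.update (stk m a b c) .a l = stk m l b c := by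
  funext r; cases r <;> rfl
@[simp] theorem update_stk_b : Function.update (stk m a b c) .b l = stk m a l c := by
  funext r; cases r <;> rfl
@[simp] theorem update_stk_cnt : Function.update (stk m a b c) .cnt l = stk m a b l := by
  funext r; cases r <;> rfl

end stk

theorem Run.cast {p : Prog} {S S' T : Reg → List Bool} {n n' : ℕ} (h : Run p S S' n)
    (hT : S' = T) (hn : n ≤ n') : Run p S T n' := hT ▸ h.mono hn

/-- Move the stack `r` symbol by symbol onto the stack `r'`. -/
def pour (r r' : Reg) : Prog :=
  .loop r Option.isSome
    (.ite r (· == some true) (.seq (.pop r) (.push r' true)) (.seq (.pop r) (.push r' false)))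

theorem run_pour {r r' : Reg} (h : r ≠ r') : ∀ (l : List Bool) (S : Reg → List Bool), S r = l →
    Run (pour r r') S (Function.update (Function.update S r' (l.reverse ++ S r')) r [])
      (4 * l.length + 1)
  | [], S, hS => by
    refine Run.cast (Run.loop_false (by simp [hS])) ?_ (by simp)
    funext k
    by_cases hk : k = r
    · subst hk; simp [hS]
    · by_cases hk' : k = r'
      · subst hk'; simp [hk]
      · simp [hk]
  | x :: l, S, hS => by
    have ih := run_pour h l (Function.update (Function.update S r l) r' (x :: S r'))
      (by simp [h])
    have hbody : Run (.ite r (· == some true) (.seq (.pop r) (.push r' true))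
        (.seq (.pop r) (.push r' false))) S
        (Function.update (Function.update S r l) r' (x :: S r')) 3 := by
      cases x with
      | true =>
        refine Run.ite_true (by simp [hS]) (Run.cast (Run.seq (Run.pop S r) (Run.push _ r' _)) ?_
          le_rfl)
        simp [hS, h.symm]
      | false =>
        refine Run.ite_false (by simp [hS]) (Run.cast (Run.seq (Run.pop S r) (Run.push _ r' _)) ?_
          le_rfl)
        simp [hS, h.symm]
    refine Run.cast (Run.loop_true (by simp [hS]) hbody ih) ?_ (by simp; omega)
    funext k
    by_cases hk : k = r
    · subst hk; simp
    · by_cases hk' : k = r'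
      · subst hk'; simp [hk]
      · simp [hk, hk']

theorem run_pour_a_main (m a b c : List Bool) :
    Run (pour .a .main) (stk m a b c) (stk (a.reverse ++ m) [] b c) (4 * a.length + 1) :=
  Run.cast (run_pour (by decide) a (stk m a b c) rfl) (by simp) le_rfl

theorem run_pour_b_main (m a b c : List Bool) :
    Run (pour .b .main) (stk m a b c) (stk (b.reverse ++ m) a [] c) (4 * b.length + 1) :=
  Run.cast (run_pour (by decide) b (stk m a b c) rfl) (by simp) le_rfl

/-- Push a symbol onto those of the stacks `a` and `b` that are selected by the flags. -/
def pushSel (fa fb x : Bool) : Prog :=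
  .seq (if fa then .push .a x else .skip) (if fb then .push .b x else .skip)

theorem run_pushSel (fa fb x : Bool) (m a b c : List Bool) :
    Run (pushSel fa fb x) (stk m a b c)
      (stk m (if fa then x :: a else a) (if fb then x :: b else b) c) 2 := by
  refine Run.seq (S' := stk m (if fa then x :: a else a) b c) (n := 1) (n' := 1) ?_ ?_
  · cases fa
    · exact Run.skip _
    · exact Run.cast (Run.push _ _ _) (by simp) le_rfl
  · cases fb
    · exact Run.skip _
    · exact Run.cast (Run.push _ _ _) (by simp) le_rfl

/-- The loop that moves trees, in Polish notation, from `main` to the selected stacks, until the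
unary counter `cnt` of trees still to be moved is empty. -/
def moveLoop (fa fb : Bool) : Prog :=
  .loop .cnt Option.isSome
    (.ite .main (· == some true)
      (.seq (.pop .main) (.seq (pushSel fa fb true) (.push .cnt true)))
      (.seq (.pop .main) (.seq (pushSel fa fb false) (.pop .cnt))))

/-- Moving one more tree. In this form, with the rest of the run as a hypothesis, the statement
admits an induction on the tree. -/
theorem run_moveLoop (fa fb : Bool) (d : D) : ∀ (m a b c : List Bool) (S : Reg → List Bool) (n : ℕ),
    Run (moveLoop fa fb)
      (stk m (if fa then d.enc.reverse ++ a else a) (if fb then d.enc.reverse ++ b else b) c) S n →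
    Run (moveLoop fa fb) (stk (d.enc ++ m) a b (true :: c)) S (n + 6 * d.size) := by
  induction d with
  | nil =>
    intro m a b c S n h
    refine (Run.loop_true (by simp) ?_ h).mono (n := 5 + n + 1) (by simp; omega)
    refine Run.ite_false (by simp [D.enc]) (Run.cast (Run.seq (Run.pop _ _)
      (Run.seq ?_ (Run.pop (stk m (if fa then false :: a else a)
        (if fb then false :: b else b) (true :: c)) _))) ?_ (le_refl (1 + (2 + 1))))
    · simpa [D.enc] using run_pushSel fa fb false m a b (true :: c)
    · simp [D.enc]
  | cons x y ihx ihy =>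
    intro m a b c S n h
    have h₁ := ihy m (if fa then x.enc.reverse ++ true :: a else a)
      (if fb then x.enc.reverse ++ true :: b else b) c S n
      (by cases fa <;> cases fb <;> simpa [D.enc] using h)
    have h₂ := ihx (y.enc ++ m) (if fa then true :: a else a) (if fb then true :: b else b)
      (true :: c) S _ (by cases fa <;> cases fb <;> simpa using h₁)
    refine (Run.loop_true (by simp) ?_ h₂).mono
      (n := 5 + (n + 6 * y.size + 6 * x.size) + 1) (by simp; omega)
    refine Run.ite_true (by simp [D.enc]) (Run.cast (Run.seq (Run.pop _ _)
      (Run.seq ?_ (Run.push (stk (x.enc ++ (y.enc ++ m)) (if fa then true :: a else a)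
        (if fb then true :: b else b) (true :: c)) _ _))) ?_ (le_refl (1 + (2 + 1))))
    · simpa [D.enc] using run_pushSel fa fb true (x.enc ++ (y.enc ++ m)) a b (true :: c)
    · simp

/-- Move the tree on top of `main` to the selected stacks (reversing it). -/
def move (fa fb : Bool) : Prog := .seq (.push .cnt true) (moveLoop fa fb)

theorem run_move (fa fb : Bool) (d : D) (m a b : List Bool) :
    Run (move fa fb) (stk (d.enc ++ m) a b [])
      (stk m (if fa then d.enc.reverse ++ a else a) (if fb then d.enc.reverse ++ b else b) [])
      (6 * d.size + 2) := by
  refine (Run.seq (Run.push _ _ _) ?_).mono (n := 1 + (1 + 6 * d.size)) (by omega)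
  simpa using run_moveLoop fa fb d m a b [] _ 1 (Run.loop_false (by simp))

/-- Stack contents between two operations: only `main` is in use. -/
abbrev mainStk (m : List Bool) : Reg → List Bool := stk m [] [] []

/-- Remove the topmost tree. -/
def drop : Prog := move false false

theorem run_drop (d : D) (m : List Bool) :
    Run drop (mainStk (d.enc ++ m)) (mainStk m) (6 * d.size + 2) := by
  exact Run.cast (run_move false false d m [] []) (by simp) le_rfl

/-- Duplicate the topmost tree. -/
def dup : Prog := .seq (move true true) (.seq (pour .a .main) (pour .b .main))

theorem run_dup (d : D) (m : List Bool) :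
    Run dup (mainStk (d.enc ++ m)) (mainStk (d.enc ++ (d.enc ++ m))) (14 * d.size + 4) := by
  refine Run.cast (Run.seq (run_move true true d m [] []) (Run.seq (run_pour_a_main _ _ _ _)
    (run_pour_b_main _ _ _ _))) ?_ ?_
  · simp
  · simp [D.size]; omega

/-- Swap the two topmost trees. -/
def swap : Prog :=
  .seq (move true false) (.seq (move false true) (.seq (pour .a .main) (pour .b .main)))

theorem run_swap (d d' : D) (m : List Bool) :
    Run swap (mainStk (d.enc ++ (d'.enc ++ m))) (mainStk (d'.enc ++ (d.enc ++ m)))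
      (10 * d.size + 10 * d'.size + 6) := by
  refine Run.cast (Run.seq (run_move true false d (d'.enc ++ m) [] [])
    (Run.seq (run_move false true d' m _ _) (Run.seq (run_pour_a_main _ _ _ _)
      (run_pour_b_main _ _ _ _)))) ?_ ?_
  · simp
  · simp [D.size]; omega

/-- Push the symbols of a string onto `main`, the last one first. -/
def pushList : List Bool → Prog
  | [] => .skip
  | x :: l => .seq (pushList l) (.push .main x)

theorem run_pushList (l m : List Bool) :
    Run (pushList l) (mainStk m) (mainStk (l ++ m)) (l.length + 1) := by
  induction l with
  | nil => exact Run.skip _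
  | cons x l ih => exact Run.cast (Run.seq ih (Run.push _ _ _)) (by simp) (by simp)

/-! ### Functions computable in polynomial time -/

/-- A representation of the elements of a type by trees. -/
class Enc (α : Type) where
  toD : α → D

/-- The size of an element: the length of the bit string that represents it. -/
def esize {α : Type} [Enc α] (a : α) : ℕ := (Enc.toD a).size

/-- The bit string that represents an element. -/
def bits {α : Type} [Enc α] (a : α) : List Bool := (Enc.toD a).enc

instance : Enc Unit := ⟨fun _ => .nil⟩

/-- Both truth values get representations of the same length, so that the size of a bit string
depends on its length only. -/
instance : Enc Bool :=
  ⟨fun b => if b then .cons (.cons .nil .nil) .nil else .cons .nil (.cons .nil .nil)⟩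

instance {α β : Type} [Enc α] [Enc β] : Enc (α × β) := ⟨fun p => .cons (Enc.toD p.1) (Enc.toD p.2)⟩

instance {α : Type} [Enc α] : Enc (List α) := ⟨List.foldr (fun a d => .cons (Enc.toD a) d) .nil⟩

/-- Natural numbers are represented in unary, as lists without content. -/
instance : Enc ℕ := ⟨fun n => Enc.toD (List.replicate n ())⟩

section size

variable {α β : Type} [Enc α] [Enc β]

theorem length_bits (a : α) : (bits a).length = esize a := rfl

theorem esize_pos (a : α) : 0 < esize a := D.size_pos _

@[simp] theorem esize_unit (a : Unit) : esize a = 1 := rfl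

@[simp] theorem esize_prod (p : α × β) : esize p = esize p.1 + esize p.2 + 1 := D.size_cons _ _

@[simp] theorem esize_nil : esize ([] : List α) = 1 := rfl

@[simp] theorem esize_cons (a : α) (l : List α) : esize (a :: l) = esize a + esize l + 1 :=
  D.size_cons _ _

theorem esize_list (l : List α) : esize l = (l.map fun a => esize a + 1).sum + 1 := by
  induction l with
  | nil => rfl
  | cons a l ih => simp [ih]; omega

@[simp] theorem esize_bool (b : Bool) : esize b = 5 := by cases b <;> rfl

@[simp] theorem esize_append (l l' : List α) : esize (l ++ l') + 1 = esize l + esize l' := by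
  simp only [esize_list, List.map_append, List.sum_append]; omega

@[simp] theorem esize_reverse (l : List α) : esize l.reverse = esize l := by
  simp [esize_list, List.sum_reverse]

theorem length_lt_esize (l : List α) : l.length < esize l := by
  induction l with
  | nil => simp
  | cons a l ih => simp; omega

theorem esize_le_of_mem {a : α} {l : List α} (h : a ∈ l) : esize a < esize l := by
  induction l with
  | nil => simp at h
  | cons b l ih =>
    rcases List.mem_cons.1 h with rfl | h
    · rw [esize_cons]; omega
    · have := ih h; simp; omega

@[simp] theorem esize_bits (l : List Bool) : esize l = 6 * l.length + 1 := by
  simp [esize_list, mul_comm]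

theorem esize_list_le {l : List α} {n : ℕ} (h : ∀ a ∈ l, esize a ≤ n) :
    esize l ≤ l.length * (n + 1) + 1 := by
  induction l with
  | nil => simp
  | cons a l ih =>
    have h₁ := h a (by simp)
    have h₂ := ih fun b hb => h b (by simp [hb])
    simp [add_mul]; omega

@[simp] theorem esize_nat (n : ℕ) : esize n = 2 * n + 1 := by
  change esize (List.replicate n ()) = _
  simp [esize_list, mul_comm]

theorem bits_prod (a : α) (b : β) : bits (a, b) = true :: (bits a ++ bits b) := rfl

theorem bits_nil : bits ([] : List α) = [false] := rfl

theorem bits_cons (a : α) (l : List α) : bits (a :: l) = true :: (bits a ++ bits l) := rfl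

end size

theorem run_pop_pair {α β : Type} [Enc α] [Enc β] (a : α) (b : β) (m : List Bool) :
    Run (.pop .main) (mainStk (bits (a, b) ++ m)) (mainStk (bits a ++ (bits b ++ m))) 1 :=
  Run.cast (Run.pop _ _) (by simp [mainStk, bits_prod]) le_rfl

theorem run_push_pair {α β : Type} [Enc α] [Enc β] (a : α) (b : β) (m : List Bool) :
    Run (.push .main true) (mainStk (bits a ++ (bits b ++ m))) (mainStk (bits (a, b) ++ m)) 1 :=
  Run.cast (Run.push _ _ _) (by simp [mainStk, bits_prod]) le_rfl

theorem eval_mono (q : Polynomial ℕ) {m n : ℕ} (h : m ≤ n) : q.eval m ≤ q.eval n := by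
  rw [Polynomial.eval_eq_sum, Polynomial.eval_eq_sum]
  exact Finset.sum_le_sum fun i _ => Nat.mul_le_mul_left _ (Nat.pow_le_pow_left h i)

/-- `g` is bounded by a polynomial in the size of its argument. -/
def PBound {α : Type} [Enc α] (g : α → ℕ) : Prop :=
  ∃ q : Polynomial ℕ, ∀ a, g a ≤ q.eval (esize a)

namespace PBound

variable {α : Type} [Enc α] {g h : α → ℕ}

theorem mono (hh : PBound h) (hg : ∀ a, g a ≤ h a) : PBound g :=
  hh.imp fun _ hq a => (hg a).trans (hq a)

theorem const (n : ℕ) : PBound fun _ : α => n := ⟨.C n, by simp⟩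

theorem size : PBound fun a : α => esize a := ⟨.X, by simp⟩

theorem add (hg : PBound g) (hh : PBound h) : PBound fun a => g a + h a := by
  obtain ⟨q, hq⟩ := hg
  obtain ⟨r, hr⟩ := hh
  exact ⟨q + r, fun a => by simpa using add_le_add (hq a) (hr a)⟩

theorem mul (hg : PBound g) (hh : PBound h) : PBound fun a => g a * h a := by
  obtain ⟨q, hq⟩ := hg
  obtain ⟨r, hr⟩ := hh
  exact ⟨q * r, fun a => by simpa using Nat.mul_le_mul (hq a) (hr a)⟩

theorem eval (q : Polynomial ℕ) (hg : PBound g) : PBound fun a => q.eval (g a) := by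
  obtain ⟨r, hr⟩ := hg
  exact ⟨q.comp r, fun a => by simpa using eval_mono q (hr a)⟩

end PBound

/-- `f` is computable in polynomial time: some program replaces the representation of `a` on top of
`main` by that of `f a`, leaving alone what lies below. -/
@[fun_prop]
def PTime {α β : Type} [Enc α] [Enc β] (f : α → β) : Prop :=
  ∃ (p : Prog) (t : α → ℕ), PBound t ∧ (PBound fun a => esize (f a)) ∧
    ∀ a m, Run p (mainStk (bits a ++ m)) (mainStk (bits (f a) ++ m)) (t a)

section calculus

variable {α β γ δ σ : Type} [Enc α] [Enc β] [Enc γ] [Enc δ] [Enc σ]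

theorem PTime.size {f : α → β} (hf : PTime f) : PBound fun a => esize (f a) := by
  obtain ⟨_, _, _, h, _⟩ := hf
  exact h

theorem PBound.comp {g : β → ℕ} {f : α → β} (hg : PBound g) (hf : PTime f) :
    PBound fun a => g (f a) := by
  obtain ⟨q, hq⟩ := hg
  exact (hf.size.eval q).mono fun a => hq _

theorem PTime.of_bits {f : α → β} (h : ∀ a, bits (f a) = bits a) : PTime f := by
  refine ⟨.skip, _, .const 1, PBound.size.mono fun a => ?_, fun a m => ?_⟩
  · rw [← length_bits, h, length_bits]
  · rw [h]; exact Run.skip _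

@[fun_prop]
theorem PTime.id : PTime fun a : α => a := .of_bits fun _ => rfl

@[fun_prop]
theorem PTime.comp {g : β → γ} {f : α → β} (hg : PTime g) (hf : PTime f) :
    PTime fun a => g (f a) := by
  have hs := hg.size.comp hf
  have hf' := hf
  obtain ⟨p, t, ht, -, hp⟩ := hf
  obtain ⟨p', t', ht', -, hp'⟩ := hg
  exact ⟨.seq p p', _, ht.add (ht'.comp hf'), hs, fun a m => Run.seq (hp a m) (hp' (f a) m)⟩

@[fun_prop]
theorem PTime.const (b : β) : PTime fun _ : α => b :=
  ⟨.seq drop (pushList (bits b)), _,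
    (((PBound.const 6).mul .size).add (.const 2)).add (.const ((bits b).length + 1)), .const _,
    fun _ m => Run.seq (run_drop _ m) (run_pushList _ _)⟩

@[fun_prop]
theorem PTime.prodMk {f : α → β} {g : α → γ} (hf : PTime f) (hg : PTime g) :
    PTime fun a => (f a, g a) := by
  have hs : PBound fun a => esize (f a, g a) := by
    simpa using (hf.size.add hg.size).add (.const 1)
  have hfs := hf.size
  have hgs := hg.size
  obtain ⟨p, t, ht, -, hp⟩ := hf
  obtain ⟨p', t', ht', -, hp'⟩ := hg
  have h14 : PBound fun a : α => 14 * esize a + 4 := ((PBound.const 14).mul .size).add (.const 4)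
  refine ⟨.seq dup (.seq p (.seq swap (.seq p' (.seq swap (.push .main true))))), _,
    h14.add (ht.add ((((((PBound.const 10).mul hfs).add ((PBound.const 10).mul .size)).add
      (.const 6))).add (ht'.add (((((PBound.const 10).mul hgs).add ((PBound.const 10).mul hfs)).add
        (.const 6)).add (.const 1))))), hs, fun a m => ?_⟩
  exact Run.seq (run_dup _ m) (Run.seq (hp a _) (Run.seq (run_swap _ _ m) (Run.seq (hp' a _)
    (Run.seq (run_swap _ _ m) (run_push_pair (f a) (g a) m)))))

theorem PTime.fst_prod : PTime (Prod.fst : α × β → α) := by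
  refine ⟨.seq (.pop .main) (.seq swap drop), fun p => 1 + (10 * esize p + 6 + (6 * esize p + 2)),
    (PBound.const 1).add ((((PBound.const 10).mul .size).add (.const 6)).add
      (((PBound.const 6).mul .size).add (.const 2))),
    PBound.size.mono fun p => by simp; omega, fun p m => ?_⟩
  have h := Run.seq (run_swap (Enc.toD p.1) (Enc.toD p.2) m) (run_drop (Enc.toD p.2) _)
  refine (Run.seq (run_pop_pair p.1 p.2 m) h).mono ?_
  have := esize_prod p
  simp only [esize] at *
  omega

theorem PTime.snd_prod : PTime (Prod.snd : α × β → β) := by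
  refine ⟨.seq (.pop .main) drop, fun p => 1 + (6 * esize p + 2),
    (PBound.const 1).add (((PBound.const 6).mul .size).add (.const 2)),
    PBound.size.mono fun p => by simp; omega, fun p m => ?_⟩
  refine (Run.seq (run_pop_pair p.1 p.2 m) (run_drop (Enc.toD p.1) _)).mono ?_
  have := esize_prod p
  simp only [esize] at *
  omega

@[fun_prop]
theorem PTime.fst {f : α → β × γ} (hf : PTime f) : PTime fun a => (f a).1 := fst_prod.comp hf

@[fun_prop]
theorem PTime.snd {f : α → β × γ} (hf : PTime f) : PTime fun a => (f a).2 := snd_prod.comp hf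

@[fun_prop]
theorem PTime.cond {c : α → Bool} {f g : α → β} (hc : PTime c) (hf : PTime f) (hg : PTime g) :
    PTime fun a => _root_.cond (c a) (f a) (g a) := by
  have hs : PBound fun a => esize (_root_.cond (c a) (f a) (g a)) :=
    (hf.size.add hg.size).mono fun a => by cases c a <;> simp
  obtain ⟨p, t, ht, -, hp⟩ := hf
  obtain ⟨p', t', ht', -, hp'⟩ := hg
  obtain ⟨q, u, hu, -, hq⟩ := hc
  have hpop (x y z w : Bool) {r : Prog} {n : ℕ} {m : List Bool} {S : Reg → List Bool}
      (h : Run r (mainStk m) S n) :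
      Run (.seq (.pop .main) (.seq (.pop .main) (.seq (.pop .main) (.seq (.pop .main) r))))
        (mainStk (x :: y :: z :: w :: m)) S (n + 4) := by
    refine (Run.seq (Run.pop _ _) (Run.seq (Run.pop _ _) (Run.seq (Run.pop _ _)
      (Run.seq (Run.pop _ _) (Run.cast ?_ rfl le_rfl))))).mono (n := 1 + (1 + (1 + (1 + n))))
        (by omega)
    simpa [mainStk] using h
  refine ⟨.seq dup (.seq q (.seq (.pop .main) (.ite .main (· == some true)
    (.seq (.pop .main) (.seq (.pop .main) (.seq (.pop .main) (.seq (.pop .main) p))))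
    (.seq (.pop .main) (.seq (.pop .main) (.seq (.pop .main) (.seq (.pop .main) p'))))))), _,
    (((PBound.const 14).mul .size).add (.const 4)).add (hu.add
      ((PBound.const 1).add (((ht.add ht').add (.const 4)).add (.const 1)))), hs, fun a m => ?_⟩
  refine Run.seq (run_dup _ m) (Run.seq (hq a _) (Run.seq (Run.pop _ _) ?_))
  cases h : c a with
  | true =>
    refine Run.ite_true (by rfl) (Run.mono (n := t a + 4) ?_ (by omega))
    simpa [bits, Enc.toD, D.enc, mainStk, h] using hpop true false false false (hp a m)
  | false =>
    refine Run.ite_false (by rfl) (Run.mono (n := t' a + 4) ?_ (by omega))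
    simpa [bits, Enc.toD, D.enc, mainStk, h] using hpop false true false false (hp' a m)

@[fun_prop]
theorem PTime.cons {f : α → β} {g : α → List β} (hf : PTime f) (hg : PTime g) :
    PTime fun a => f a :: g a :=
  (PTime.of_bits (f := fun p : β × List β => p.1 :: p.2) fun _ => rfl).comp (hf.prodMk hg)

@[fun_prop]
theorem PTime.isEmpty {f : α → List β} (hf : PTime f) : PTime fun a => (f a).isEmpty := by
  refine PTime.comp (g := List.isEmpty) ?_ hf
  refine ⟨.ite .main (· == some true) (.seq drop (pushList (bits false)))
    (.seq drop (pushList (bits true))), fun l => ((6 * esize l + 2) + 6) + 1,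
    ((((PBound.const 6).mul .size).add (.const 2)).add (.const 6)).add (.const 1),
    (PBound.const 5).mono fun l => (esize_bool _).le, fun l m => ?_⟩
  have h (b : Bool) : Run (.seq drop (pushList (bits b))) (mainStk (bits l ++ m))
      (mainStk (bits b ++ m)) ((6 * esize l + 2) + 6) :=
    (Run.seq (run_drop (Enc.toD l) m) (run_pushList (bits b) m)).mono
      (Nat.add_le_add_left (by cases b <;> decide) _)
  cases l with
  | nil => exact Run.ite_false rfl (h true)
  | cons b l => exact Run.ite_true rfl (h false)

theorem PTime.headD_list (b : β) : PTime fun l : List β => l.headD b := by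
  refine ⟨.ite .main (· == some true) (.seq (.pop .main) (.seq swap drop))
    (.seq (.pop .main) (pushList (bits b))), fun l => (17 * esize l + 9 + esize b) + 1,
    ((((PBound.const 17).mul .size).add (.const 9)).add (.const _)).add (.const 1),
    (PBound.size.add (.const (esize b))).mono fun l => by cases l <;> simp; omega, fun l m => ?_⟩
  cases l with
  | nil =>
    refine Run.ite_false rfl ((Run.seq (S' := mainStk m) (n := 1)
      (Run.cast (Run.pop _ _) ?_ le_rfl) (run_pushList _ _)).mono ?_)
    · simp [mainStk, bits_nil]
    · have := length_bits b
      omega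
  | cons a l =>
    have h := Run.seq (run_swap (Enc.toD a) (Enc.toD l) m) (run_drop (Enc.toD l) _)
    refine Run.ite_true rfl ((Run.seq (run_pop_pair a l m) h).mono ?_)
    have := esize_cons a l
    simp only [esize] at *
    omega

@[fun_prop]
theorem PTime.headD {f : α → List β} {b : β} (hf : PTime f) : PTime fun a => (f a).headD b :=
  (headD_list b).comp hf

@[fun_prop]
theorem PTime.tail {f : α → List β} (hf : PTime f) : PTime fun a => (f a).tail := by
  refine PTime.comp (g := List.tail) ?_ hf
  refine ⟨.ite .main (· == some true) (.seq (.pop .main) drop) .skip,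
    fun l => (6 * esize l + 3) + 1, (((PBound.const 6).mul .size).add (.const 3)).add (.const 1),
    PBound.size.mono fun l => by cases l <;> simp; omega, fun l m => ?_⟩
  cases l with
  | nil => exact Run.ite_false rfl ((Run.skip _).mono (by omega))
  | cons a l =>
    refine Run.ite_true rfl ((Run.seq (run_pop_pair a l m) (run_drop (Enc.toD a) _)).mono ?_)
    have := esize_cons a l
    simp only [esize] at *
    omega

/-- The loop behind `PTime.foldl`: as long as the list on top of `main` is not empty, perform a
step of the fold. -/
def foldLoop (p : Prog) : Prog :=
  .loop .main (· == some true) (.seq (.push .main true) (.seq p (.pop .main)))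

theorem run_foldLoop {p : Prog} {g : List α × σ → List α × σ} {t : List α × σ → ℕ} {f : σ → α → σ}
    (hg : ∀ a l x, g (a :: l, x) = (l, f x a))
    (hp : ∀ y m, Run p (mainStk (bits y ++ m)) (mainStk (bits (g y) ++ m)) (t y)) {B : ℕ} :
    ∀ (l : List α) (x : σ),
      (∀ l₁ l₂ : List α, l₁ ++ l₂ = l → t (l₂, l₁.foldl f x) ≤ B) → ∀ m,
      Run (foldLoop p) (mainStk (bits l ++ (bits x ++ m)))
        (mainStk (false :: (bits (l.foldl f x) ++ m))) (l.length * (B + 3) + 1)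
  | [], x, _, m => (Run.loop_false rfl).mono (by simp)
  | a :: l, x, hB, m => by
    have ih := run_foldLoop hg hp l (f x a)
      (fun l₁ l₂ h => hB (a :: l₁) l₂ (by simp [h])) m
    have h0 : t (a :: l, x) ≤ B := hB [] (a :: l) rfl
    refine (Run.loop_true rfl (n := 1 + (B + 1)) ?_ ih).mono (by simp [add_mul]; omega)
    refine Run.seq (Run.push _ _ _) (Run.seq (S' := mainStk (bits (l, f x a) ++ m)) ?_
      (Run.cast (Run.pop _ _) ?_ le_rfl))
    · rw [← hg]
      refine Run.mono ?_ h0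
      simpa [mainStk, bits_prod] using hp (a :: l, x) m
    · simp [mainStk, bits_prod]

/-- Folds are computable in polynomial time provided that the intermediate results are of
polynomial size. -/
theorem PTime.foldl [Inhabited α] {l : γ → List α} {i : γ → σ} {f : γ → σ → α → σ} (hl : PTime l)
    (hi : PTime i) (hf : PTime fun p : γ × σ × α => f p.1 p.2.1 p.2.2) {s : γ → ℕ} (hs : PBound s)
    (hb : ∀ c l', l' <+: l c → esize (l'.foldl (f c) (i c)) ≤ s c) :
    PTime fun c => (l c).foldl (f c) (i c) := by
  let g : List α × γ × σ → List α × γ × σ := fun y =>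
    (y.1.tail, y.2.1, f y.2.1 y.2.2 (y.1.headD default))
  have hg : PTime g := by
    have := PTime.comp (f := fun y : List α × γ × σ => (y.2.1, y.2.2, y.1.headD default)) hf
      (by fun_prop)
    fun_prop
  have hfold (c : γ) : ∀ (l : List α) (x : σ),
      l.foldl (fun y a => (y.1, f y.1 y.2 a)) (c, x) = (c, l.foldl (f c) x) := fun l => by
    induction l with
    | nil => intro x; rfl
    | cons a l ih => intro x; exact ih _
  have hsize : PBound fun c => esize ((l c).foldl (f c) (i c)) :=
    hs.mono fun c => hb c _ (List.prefix_refl _)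
  suffices h : PTime fun c => (c, (l c).foldl (f c) (i c)) from h.snd
  have h0 : PTime fun c => (l c, c, i c) := by fun_prop
  obtain ⟨p₀, t₀, ht₀, -, hp₀⟩ := h0
  obtain ⟨p, t, ⟨q, hq⟩, -, hp⟩ := hg
  refine ⟨.seq p₀ (.seq (.pop .main) (.seq (foldLoop p) (.pop .main))), _,
    ht₀.add ((PBound.const 1).add ((((hl.size).mul (((((hl.size.add .size).add hs).add
      (.const 2)).eval q).add (.const 3))).add (.const 1)).add (.const 1))),
    ((PBound.size.add hsize).add (.const 1)).mono fun c => by simp, fun c m => ?_⟩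
  refine Run.seq (hp₀ c m) (Run.seq (run_pop_pair (l c) (c, i c) m)
      (Run.seq (S' := mainStk (false :: (bits (c, (l c).foldl (f c) (i c)) ++ m))) ?_
        (Run.cast (Run.pop _ _) (by simp [mainStk]) le_rfl)))
  rw [← hfold]
  refine (run_foldLoop (B := q.eval (esize (l c) + esize c + s c + 2)) (fun a l x => rfl) hp (l c)
    (c, i c) (fun l₁ l₂ h => ?_) m).mono ?_
  · refine (hq _).trans (eval_mono q ?_)
    have h₁ := hb c l₁ ⟨l₂, h⟩
    have h₂ : esize l₂ ≤ esize (l c) := by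
      have := esize_append l₁ l₂
      rw [h] at this
      have := esize_pos l₁
      omega
    rw [hfold]
    simp
    omega
  · have := length_lt_esize (l c)
    gcongr

end calculus

/-! ### From polynomial-time functions to Turing machines -/

/-- The control labels of the machine, besides those of the program that it runs. -/
inductive Ctl
  | start | read | put (g : Γ') | write
  deriving Fintype

/-- Push the symbols of a string onto `main`, the last one first, within a single statement. -/
def pushBits {L : Type} (l : List Bool) (q : Turing.TM2.Stmt Stack.Alphabet L (Option Γ')) :
    Turing.TM2.Stmt Stack.Alphabet L (Option Γ') :=
  l.foldl (fun q x => .push (.reg .main) (fun _ => x) q) q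

theorem stepAux_pushBits {L : Type} (l : List Bool)
    (q : Turing.TM2.Stmt Stack.Alphabet L (Option Γ')) (v : Option Γ') (i : List Γ')
    (o m : List Bool) :
    Turing.TM2.stepAux (pushBits l q) v (contents i o (mainStk m)) =
      Turing.TM2.stepAux q v (contents i o (mainStk (l ++ m))) := by
  induction l generalizing q with
  | nil => rfl
  | cons x l ih =>
    refine (ih _).trans ?_
    simp [update_contents_reg, mainStk]

/-- The machine that reads its input, symbol by symbol, into a list on `main` (in reverse order),
runs the program `p`, and writes the resulting truth value to the output. -/
def machineStmt {τ : Type} [Enc τ] (sym : Γ' → τ) (p : Prog) : Lab p ⊕ Ctl →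
    Turing.TM2.Stmt Stack.Alphabet (Lab p ⊕ Ctl) (Option Γ')
  | .inl l => compile p Sum.inl (Sum.inr .write) l
  | .inr .start => pushBits (bits ([] : List τ)) (.goto fun _ => .inr .read)
  | .inr .read => .pop .inp (fun _ o => o) (.branch Option.isSome
      (.goto fun v => .inr (.put (v.getD Γ'.blank))) (.goto fun _ => .inl (Lab.entry p)))
  | .inr (.put g) => pushBits (true :: bits (sym g)) (.goto fun _ => .inr .read)
  | .inr .write => .pop (.reg .main) (fun v _ => v)
      (.pop (.reg .main) (fun _ o => if o = some true then some Γ'.blank else none)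
        (.push .out Option.isSome (.pop (.reg .main) (fun v _ => v)
          (.pop (.reg .main) (fun v _ => v) (.pop (.reg .main) (fun v _ => v)
            (.load (fun _ => none) .halt))))))

/-- The machine with the program `machineStmt`. -/
def machine {τ : Type} [Enc τ] (sym : Γ' → τ) (p : Prog) : Turing.FinTM2 where
  K := Stack
  k₀ := .inp
  k₁ := .out
  Γ := Stack.Alphabet
  Λ := Lab p ⊕ Ctl
  main := .inr .start
  σ := Option Γ'
  initialState := none
  Γk₀Fin := inferInstanceAs (Fintype Γ')
  m := machineStmt sym p

section

variable {τ : Type} [Enc τ] (sym : Γ' → τ) (p : Prog)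

theorem steps_read (i : List Γ') (l : List τ) (v : Option Γ') :
    Steps (machineStmt sym p) (2 * i.length + 1)
      ⟨some (.inr .read), v, contents i [] (mainStk (bits l))⟩
      ⟨some (.inl (Lab.entry p)), none,
        contents [] [] (mainStk (bits ((i.map sym).reverse ++ l)))⟩ := by
  induction i generalizing l v with
  | nil =>
    refine (Steps.single ?_).mono (by simp)
    have : Function.update (contents [] [] (mainStk (bits l))) .inp [] =
        contents [] [] (mainStk (bits l)) := by
      funext k; cases k <;> rfl
    simp [machineStmt, contents, this]
  | cons g i ih =>
    have h₁ : Steps (machineStmt sym p) 1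
        ⟨some (.inr .read), v, contents (g :: i) [] (mainStk (bits l))⟩
        ⟨some (.inr (.put g)), some g, contents i [] (mainStk (bits l))⟩ := by
      refine Steps.single ?_
      have : Function.update (contents (g :: i) [] (mainStk (bits l))) .inp i =
          contents i [] (mainStk (bits l)) := by
        funext k; cases k <;> rfl
      simp [machineStmt, contents, this]
    have h₂ : Steps (machineStmt sym p) 1
        ⟨some (.inr (.put g)), some g, contents i [] (mainStk (bits l))⟩
        ⟨some (.inr .read), some g, contents i [] (mainStk (bits (sym g :: l)))⟩ := by
      refine Steps.single ?_
      rw [machineStmt, stepAux_pushBits]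
      simp [bits_cons]
    have h := (h₁.trans h₂).trans (ih (sym g :: l) (some g))
    rw [show (g :: i).map sym = sym g :: i.map sym from rfl, List.reverse_cons, List.append_assoc]
    exact h.mono (by rw [List.length_cons]; omega)

theorem steps_write (b : Bool) (v : Option Γ') :
    Steps (machineStmt sym p) 1
      ⟨some (.inr .write), v, contents [] [] (mainStk (bits b))⟩
      ⟨none, none, contents [] [b] (mainStk [])⟩ := by
  refine Steps.single ?_
  have h (S : Reg → List Bool) (o : List Bool) : Function.update (contents [] [] S) .out o =
      contents [] o S := by
    funext k; cases k <;> rfl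
  have h' (S : Reg → List Bool) : contents [] [] S .out = [] := rfl
  cases b <;> simp [machineStmt, update_contents_reg, h, h', bits, Enc.toD, D.enc, mainStk]

end

/-- A property that some polynomial-time function on the reversed input string decides is decidable
in polynomial time in the sense of Turing machines. -/
theorem PTime.decidableInPolyTimeOn {α τ : Type} [Enc τ] {enc : α → List Γ'}
    {promise q : α → Prop} {f : List τ → Bool} (hf : PTime f) (sym : Γ' → τ)
    (h : ∀ x, promise x → (f ((enc x).map sym).reverse = true ↔ q x)) :
    DecidableInPolyTimeOn enc promise q := by
  obtain ⟨p, t, ⟨r, hr⟩, -, hp⟩ := hf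
  let B : ℕ := Finset.univ.sup fun g => esize (sym g)
  have hB (l : List Γ') : esize (l.map sym).reverse ≤ (B + 1) * l.length + 1 := by
    rw [esize_reverse]
    refine (esize_list_le (n := B) fun a ha => ?_).trans (by simp [mul_comm])
    obtain ⟨g, -, rfl⟩ := List.mem_map.1 ha
    exact Finset.le_sup (f := fun g => esize (sym g)) (Finset.mem_univ g)
  let time : Polynomial ℕ := 2 * .X + 3 + r.comp (.C (B + 1) * .X + 1)
  have hrun (l : List Γ') : Steps (machineStmt sym p) (time.eval l.length)
      ⟨some (.inr .start), none, contents l [] (mainStk [])⟩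
      ⟨none, none, contents [] [f (l.map sym).reverse] (mainStk [])⟩ := by
    have h₁ : Steps (machineStmt sym p) 1 ⟨some (.inr .start), none, contents l [] (mainStk [])⟩
        ⟨some (.inr .read), none, contents l [] (mainStk (bits ([] : List τ)))⟩ := by
      refine Steps.single ?_
      rw [machineStmt, stepAux_pushBits]
      simp
    have h₂ := steps_read sym p l [] none
    obtain ⟨v, h₃⟩ := (hp (l.map sym).reverse []).steps [] [] Sum.inl (Sum.inr .write)
      (M := machineStmt sym p) (fun _ => rfl) none
    have h₄ := steps_write sym p (f (l.map sym).reverse) v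
    simp only [List.append_nil] at h₂ h₃
    refine (((h₁.trans h₂).trans h₃).trans h₄).mono ?_
    have := (hr (l.map sym).reverse).trans (eval_mono r (hB l))
    simp [time]
    omega
  refine ⟨fun x => f ((enc x.1).map sym).reverse, fun x => h x.1 x.2, ?_⟩
  refine ⟨{
    tm := machine sym p
    inputAlphabet := Equiv.refl _
    outputAlphabet := Equiv.refl _
    time := time
    outputsFun := fun x => ?_ }, fun k => ?_⟩
  · refine Classical.choice ?_
    obtain ⟨n, hn, e⟩ := hrun (enc x.1)
    refine ⟨⟨⟨n, ?_⟩, hn⟩⟩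
    have h₀ : Turing.initList (machine sym p) ((enc x.1).map (Equiv.refl Γ').invFun) =
        ⟨some (.inr .start), none, contents (enc x.1) [] (mainStk [])⟩ := by
      unfold Turing.initList
      congr 1
      funext k
      rcases k with _ | _ | r
      · exact (dif_pos rfl).trans (List.map_id _)
      · rfl
      · cases r <;> rfl
    have h₁ : Turing.haltList (machine sym p) ((Computability.encodeBool
        (f ((enc x.1).map sym).reverse)).map (Equiv.refl Bool).invFun) =
        ⟨none, none, contents [] [f ((enc x.1).map sym).reverse] (mainStk [])⟩ := by
      unfold Turing.haltList
      congr 1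
      funext k
      rcases k with _ | _ | r
      · rfl
      · exact (dif_pos rfl).trans (List.map_id _)
      · cases r <;> rfl
    exact (congrArg _ (congrArg some h₀)).trans (e.trans (congrArg some h₁.symm))
  · rcases k with _ | _ | r
    · exact inferInstanceAs (Finite Γ')
    · exact inferInstanceAs (Finite Bool)
    · exact inferInstanceAs (Finite Bool)

/-! ### List operations in polynomial time -/

section lists

variable {α β γ δ σ : Type} [Enc α] [Enc β] [Enc γ] [Enc δ] [Enc σ]

theorem PTime.congr {f g : α → β} (hf : PTime f) (h : ∀ a, g a = f a) : PTime g :=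
  (funext h : g = f) ▸ hf

/-- Folds are computable in polynomial time if each step increases the size of the intermediate
result by an amount that does not depend on that result. -/
theorem PTime.foldl_of_add [Inhabited α] {l : γ → List α} {i : γ → σ} {f : γ → σ → α → σ}
    (hl : PTime l) (hi : PTime i) (hf : PTime fun p : γ × σ × α => f p.1 p.2.1 p.2.2) {k : γ → ℕ}
    (hk : PBound k) (hb : ∀ c x, ∀ a ∈ l c, esize (f c x a) ≤ esize x + k c) :
    PTime fun c => (l c).foldl (f c) (i c) := by
  refine PTime.foldl hl hi hf (hi.size.add (hl.size.mul hk)) fun c l' h => ?_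
  have key : ∀ (l' : List α) (x : σ), (∀ a ∈ l', a ∈ l c) →
      esize (l'.foldl (f c) x) ≤ esize x + l'.length * k c := by
    intro l'
    induction l' with
    | nil => intro x _; simp
    | cons a l' ih =>
      intro x ha
      have h₁ := ih (f c x a) fun b hb => ha b (by simp [hb])
      have h₂ := hb c x a (ha a (by simp))
      simp only [List.foldl_cons, List.length_cons, add_mul]
      omega
  refine (key l' (i c) fun a ha => h.subset ha).trans ?_
  gcongr
  exact h.length_le.trans (length_lt_esize _).le

@[fun_prop]
theorem PTime.reverse [Inhabited α] {l : γ → List α} (hl : PTime l) :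
    PTime fun c => (l c).reverse := by
  refine PTime.congr (PTime.foldl_of_add (i := fun _ => []) (f := fun _ x a => a :: x) hl
    (by fun_prop) (by fun_prop) hl.size fun c x a ha => ?_) fun c => by simp
  have := esize_le_of_mem ha
  simp; omega

@[fun_prop]
theorem PTime.append [Inhabited α] {l l' : γ → List α} (hl : PTime l) (hl' : PTime l') :
    PTime fun c => l c ++ l' c := by
  refine PTime.congr (PTime.foldl_of_add (l := fun c => (l c).reverse) (i := l')
    (f := fun _ x a => a :: x) (by fun_prop) hl' (by fun_prop) hl.size fun c x a ha => ?_)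
    fun c => by simp
  have := esize_le_of_mem (List.mem_reverse.1 ha)
  simp; omega

/-- A polynomially bounded function of an element of a list is polynomially bounded uniformly in
that element. -/
theorem PBound.of_mem {l : γ → List α} (hl : PTime l) {g : γ × α → ℕ} (hg : PBound g) :
    ∃ k : γ → ℕ, PBound k ∧ ∀ c, ∀ a ∈ l c, g (c, a) ≤ k c := by
  obtain ⟨q, hq⟩ := hg
  refine ⟨_, ((PBound.size.add hl.size).add (.const 1)).eval q, fun c a ha => ?_⟩
  refine (hq _).trans (eval_mono q ?_)
  have := esize_le_of_mem ha
  simp; omega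

theorem PTime.flatMap [Inhabited α] [Inhabited β] {l : γ → List α} {f : γ → α → List β}
    (hl : PTime l) (hf : PTime fun p : γ × α => f p.1 p.2) :
    PTime fun c => (l c).flatMap (f c) := by
  obtain ⟨k, hk, hb⟩ := PBound.of_mem hl hf.size
  have hf' : PTime fun p : γ × List β × α => f p.1 p.2.2 :=
    hf.comp (f := fun p : γ × List β × α => (p.1, p.2.2)) (by fun_prop)
  refine PTime.congr (PTime.foldl_of_add (l := fun c => (l c).reverse) (i := fun _ => [])
    (f := fun c x a => f c a ++ x) (by fun_prop) (by fun_prop) (by fun_prop) hk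
    fun c x a ha => ?_) fun c => ?_
  · have h₁ := esize_append (f c a) x
    have h₂ := hb c a (List.mem_reverse.1 ha)
    simp only at h₂
    omega
  · rw [List.foldl_reverse]
    induction l c with
    | nil => rfl
    | cons a l ih => simp [ih]

theorem PTime.map [Inhabited α] [Inhabited β] {l : γ → List α} {f : γ → α → β}
    (hl : PTime l) (hf : PTime fun p : γ × α => f p.1 p.2) :
    PTime fun c => (l c).map (f c) :=
  PTime.congr (PTime.flatMap (f := fun c a => [f c a]) hl (by fun_prop)) fun c => by
    induction l c with
    | nil => rfl
    | cons a l ih => simp [ih]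

theorem PTime.filter [Inhabited α] {l : γ → List α} {f : γ → α → Bool}
    (hl : PTime l) (hf : PTime fun p : γ × α => f p.1 p.2) :
    PTime fun c => (l c).filter (f c) :=
  PTime.congr (PTime.flatMap (f := fun c a => bif f c a then [a] else []) hl (by fun_prop))
    fun c => by
      induction l c with
      | nil => rfl
      | cons a l ih => cases h : f c a <;> simp [ih, h]

@[fun_prop]
theorem PTime.and {f g : γ → Bool} (hf : PTime f) (hg : PTime g) : PTime fun c => f c && g c :=
  PTime.congr (hf.cond hg (PTime.const false)) fun c => by cases f c <;> simp

@[fun_prop]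
theorem PTime.not {f : γ → Bool} (hf : PTime f) : PTime fun c => !f c :=
  PTime.congr (hf.cond (PTime.const false) (PTime.const true)) fun c => by cases f c <;> simp

@[fun_prop]
theorem PTime.or {f g : γ → Bool} (hf : PTime f) (hg : PTime g) : PTime fun c => f c || g c :=
  PTime.congr (hf.cond (PTime.const true) hg) fun c => by cases f c <;> simp

@[fun_prop]
theorem PTime.xor {f g : γ → Bool} (hf : PTime f) (hg : PTime g) : PTime fun c => f c ^^ g c :=
  PTime.congr (hf.cond (hg.not) hg) fun c => by cases f c <;> simp

theorem PTime.all [Inhabited α] {l : γ → List α} {f : γ → α → Bool}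
    (hl : PTime l) (hf : PTime fun p : γ × α => f p.1 p.2) :
    PTime fun c => (l c).all (f c) := by
  have h := PTime.filter (f := fun c a => !f c a) hl (by fun_prop)
  refine PTime.congr h.isEmpty fun c => ?_
  induction l c with
  | nil => rfl
  | cons a l ih => cases h : f c a <;> simp [ih, h]

/-! ### Natural numbers in unary -/

@[fun_prop]
theorem PTime.replicate {f : γ → ℕ} (hf : PTime f) : PTime fun c => List.replicate (f c) () :=
  (PTime.of_bits (f := fun n : ℕ => List.replicate n ()) fun _ => rfl).comp hf

@[fun_prop]
theorem PTime.length [Inhabited α] {l : γ → List α} (hl : PTime l) :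
    PTime fun c => (l c).length := by
  have h : PTime fun l : List Unit => l.length := PTime.of_bits fun l => by
    conv_rhs => rw [List.eq_replicate_of_mem (a := ()) (l := l) fun _ _ => rfl]
    rfl
  refine PTime.congr (h.comp (PTime.map (f := fun _ _ => ()) hl (by fun_prop))) fun c => by simp

@[fun_prop]
theorem PTime.succ {f : γ → ℕ} (hf : PTime f) : PTime fun c => f c + 1 :=
  PTime.congr (f := fun c => (() :: List.replicate (f c) ()).length) (by fun_prop) fun c => by simp

@[fun_prop]
theorem PTime.drop {n : γ → ℕ} {l : γ → List α} (hn : PTime n) (hl : PTime l) :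
    PTime fun c => (l c).drop (n c) := by
  refine PTime.congr (PTime.foldl_of_add (l := fun c => List.replicate (n c) ()) (i := l)
    (f := fun _ x _ => x.tail) (by fun_prop) hl (by fun_prop) (.const 0) fun c x a ha => ?_)
    fun c => ?_
  · cases x <;> simp; omega
  · generalize l c = l
    induction n c generalizing l with
    | zero => rfl
    | succ n ih => rw [List.replicate_succ, List.foldl_cons, ← ih, List.drop_tail]

@[fun_prop]
theorem PTime.beq_nat {f g : γ → ℕ} (hf : PTime f) (hg : PTime g) : PTime fun c => f c == g c :=
  PTime.congr (f := fun c => ((List.replicate (f c) ()).drop (g c)).isEmpty &&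
    ((List.replicate (g c) ()).drop (f c)).isEmpty) (by fun_prop) fun c => by
      rw [Bool.eq_iff_iff]; simp; omega

@[fun_prop]
theorem PTime.beq_prod {f g : γ → ℕ × ℕ} (hf : PTime f) (hg : PTime g) :
    PTime fun c => f c == g c :=
  PTime.congr (f := fun c => (f c).1 == (g c).1 && (f c).2 == (g c).2) (by fun_prop) fun _ => rfl

@[fun_prop]
theorem PTime.range {n : γ → ℕ} (hn : PTime n) : PTime fun c => List.range (n c) := by
  have key (k : ℕ) : (List.replicate k ()).foldl (fun (x : List ℕ) _ => x ++ [x.length]) [] =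
      List.range k := by
    induction k with
    | zero => rfl
    | succ k ih => rw [List.replicate_succ', List.foldl_append, ih, List.range_succ]; simp
  refine PTime.congr (PTime.foldl (l := fun c => List.replicate (n c) ()) (i := fun _ => [])
    (f := fun _ x _ => x ++ [x.length]) (by fun_prop) (by fun_prop) (by fun_prop)
    ((hn.size.mul (hn.size.add (.const 1))).add (.const 1)) fun c l' h => ?_)
    fun c => (key _).symm
  obtain ⟨k, hk, rfl⟩ : ∃ k ≤ n c, l' = List.replicate k () :=
    ⟨l'.length, by simpa using h.length_le, List.eq_replicate_of_mem fun _ _ => rfl⟩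
  rw [key]
  refine (esize_list_le (n := 2 * n c + 1) fun a ha => ?_).trans ?_
  · have := List.mem_range.1 ha
    simp; omega
  · simp only [List.length_range, esize_nat]
    gcongr
    omega

end lists

/-! ### Binary arithmetic -/

/-- The number with the given binary digits, least significant digit first. Leading zeros are
allowed. -/
def bitVal : List Bool → ℕ
  | [] => 0
  | b :: l => b.toNat + 2 * bitVal l

/-- Pair up the digits of two numbers, padding the shorter one with zeros. -/
def zipPad : List Bool → List Bool → List (Bool × Bool)
  | [], y => y.map fun b => (false, b)
  | a :: x, y => (a, y.headD false) :: zipPad x y.tail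

theorem length_zipPad (x y : List Bool) : (zipPad x y).length = max x.length y.length := by
  induction x generalizing y with
  | nil => simp [zipPad]
  | cons a x ih => simp [zipPad, ih]; omega

theorem bitVal_headD_tail (y : List Bool) :
    (y.headD false).toNat + 2 * bitVal y.tail = bitVal y := by
  cases y <;> rfl

theorem bitVal_fst_zipPad (x y : List Bool) : bitVal ((zipPad x y).map Prod.fst) = bitVal x := by
  induction x generalizing y with
  | nil => induction y with
    | nil => rfl
    | cons b y ih => simpa [zipPad, bitVal] using ih
  | cons a x ih => simp [zipPad, bitVal, ih]

theorem bitVal_snd_zipPad (x y : List Bool) : bitVal ((zipPad x y).map Prod.snd) = bitVal y := by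
  induction x generalizing y with
  | nil => simp [zipPad, Function.comp_def]
  | cons a x ih => simp [zipPad, bitVal, ih, bitVal_headD_tail, -List.headD_eq_head?_getD]

/-- Addition with carry of paired digits. -/
def addCarry : Bool → List (Bool × Bool) → List Bool
  | c, [] => [c]
  | c, p :: l => (p.1 ^^ p.2 ^^ c) :: addCarry ((p.1 && p.2) || (c && (p.1 || p.2))) l

/-- Addition of binary numbers. -/
def addBits (x y : List Bool) : List Bool := addCarry false (zipPad x y)

theorem length_addCarry (c : Bool) (l : List (Bool × Bool)) :
    (addCarry c l).length = l.length + 1 := by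
  induction l generalizing c with
  | nil => rfl
  | cons p l ih => simp [addCarry, ih]

theorem bitVal_addCarry (c : Bool) (l : List (Bool × Bool)) :
    bitVal (addCarry c l) = bitVal (l.map Prod.fst) + bitVal (l.map Prod.snd) + c.toNat := by
  induction l generalizing c with
  | nil => simp [addCarry, bitVal]
  | cons p l ih =>
    obtain ⟨a, b⟩ := p
    simp only [addCarry, bitVal, ih, List.map_cons]
    cases a <;> cases b <;> cases c <;> simp <;> omega

theorem bitVal_addBits (x y : List Bool) : bitVal (addBits x y) = bitVal x + bitVal y := by
  simp [addBits, bitVal_addCarry, bitVal_fst_zipPad, bitVal_snd_zipPad]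

theorem length_addBits (x y : List Bool) :
    (addBits x y).length = max x.length y.length + 1 := by
  simp [addBits, length_addCarry, length_zipPad]

/-- Comparison of paired digits: the most significant difference decides, and the flag `s` decides
if there is no difference. -/
def leCarry (s : Bool) (l : List (Bool × Bool)) : Bool :=
  l.foldl (fun s p => bif p.1 ^^ p.2 then p.2 else s) s

/-- Comparison of binary numbers. -/
def leBits (x y : List Bool) : Bool := leCarry true (zipPad x y)

theorem leCarry_iff (s : Bool) (l : List (Bool × Bool)) : leCarry s l = true ↔
    bitVal (l.map Prod.fst) + (!s).toNat ≤ bitVal (l.map Prod.snd) := by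
  induction l generalizing s with
  | nil => cases s <;> simp [leCarry, bitVal]
  | cons p l ih =>
    obtain ⟨a, b⟩ := p
    have h : leCarry s ((a, b) :: l) = leCarry (bif a ^^ b then b else s) l := rfl
    rw [h, ih]
    simp only [bitVal, List.map_cons]
    cases a <;> cases b <;> cases s <;> simp <;> omega

theorem leBits_iff (x y : List Bool) : leBits x y = true ↔ bitVal x ≤ bitVal y := by
  simp [leBits, leCarry_iff, bitVal_fst_zipPad, bitVal_snd_zipPad]

/-- Multiplication of binary numbers. -/
def mulBits (x y : List Bool) : List Bool :=
  x.foldr (fun b z => addBits (false :: z) (bif b then y else [])) []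

theorem bitVal_mulBits (x y : List Bool) : bitVal (mulBits x y) = bitVal x * bitVal y := by
  induction x with
  | nil => simp [mulBits, bitVal]
  | cons b x ih =>
    have h : mulBits (b :: x) y = addBits (false :: mulBits x y) (bif b then y else []) := rfl
    rw [h, bitVal_addBits]
    cases b <;> simp [bitVal, ih] <;> ring

theorem length_mulBits (x y : List Bool) : (mulBits x y).length ≤ y.length + 2 * x.length := by
  induction x with
  | nil => simp [mulBits]
  | cons b x ih =>
    have h : mulBits (b :: x) y = addBits (false :: mulBits x y) (bif b then y else []) := rfl
    rw [h, length_addBits]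
    cases b <;> simp <;> omega

section

variable {γ : Type} [Enc γ] {x y : γ → List Bool}

@[fun_prop]
theorem PTime.zipPad (hx : PTime x) (hy : PTime y) : PTime fun c => zipPad (x c) (y c) := by
  let f : List Bool × List (Bool × Bool) → Bool → List Bool × List (Bool × Bool) := fun s a =>
    (s.1.tail, (a, s.1.headD false) :: s.2)
  have h : PTime fun c => (x c).foldl f (y c, []) :=
    PTime.foldl_of_add (f := fun _ => f) hx (by fun_prop) (by fun_prop) (.const 12)
      fun c s a _ => by simp [f]; omega
  refine PTime.congr (f := fun c => ((x c).foldl f (y c, [])).2.reverse ++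
    ((x c).foldl f (y c, [])).1.map fun b => (false, b))
    (PTime.append h.snd.reverse (PTime.map h.fst (by fun_prop))) fun c => ?_
  have key (x : List Bool) : ∀ (y : List Bool) (l : List (Bool × Bool)),
      l.reverse ++ PolyTime.zipPad x y =
        (x.foldl f (y, l)).2.reverse ++ (x.foldl f (y, l)).1.map fun b => (false, b) := by
    induction x with
    | nil => intro y l; rfl
    | cons a x ih => intro y l; rw [List.foldl_cons, ← ih]; simp [PolyTime.zipPad]
  exact key (x c) (y c) []

@[fun_prop]
theorem PTime.addBits (hx : PTime x) (hy : PTime y) : PTime fun c => addBits (x c) (y c) := by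
  let f : Bool × List Bool → Bool × Bool → Bool × List Bool := fun s p =>
    ((p.1 && p.2) || (s.1 && (p.1 || p.2)), (p.1 ^^ p.2 ^^ s.1) :: s.2)
  have h : PTime fun c => (PolyTime.zipPad (x c) (y c)).foldl f (false, []) :=
    PTime.foldl_of_add (f := fun _ => f) (by fun_prop) (by fun_prop) (by fun_prop) (.const 6)
      fun c s a _ => by simp [f]; omega
  refine PTime.congr (PTime.reverse (PTime.cons h.fst h.snd)) fun c => ?_
  have key (l : List (Bool × Bool)) : ∀ (c : Bool) (z : List Bool), z.reverse ++ addCarry c l =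
      ((l.foldl f (c, z)).1 :: (l.foldl f (c, z)).2).reverse := by
    induction l with
    | nil => intro c z; simp [addCarry]
    | cons p l ih => intro c z; rw [List.foldl_cons, ← ih]; simp [addCarry]
  exact key _ false []

@[fun_prop]
theorem PTime.leBits (hx : PTime x) (hy : PTime y) : PTime fun c => leBits (x c) (y c) :=
  PTime.foldl_of_add (f := fun _ (s : Bool) (p : Bool × Bool) => bif p.1 ^^ p.2 then p.2 else s)
    (by fun_prop) (by fun_prop) (by fun_prop) (.const 0) fun c s a _ => by simp

@[fun_prop]
theorem PTime.mulBits (hx : PTime x) (hy : PTime y) : PTime fun c => mulBits (x c) (y c) := by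
  refine PTime.congr (PTime.foldl_of_add (l := fun c => (x c).reverse) (i := fun _ => [])
    (f := fun c z b => PolyTime.addBits (false :: z) (bif b then y c else [])) (by fun_prop)
    (by fun_prop) (by fun_prop) (hy.size.add (.const 12)) fun c z b _ => ?_)
    fun c => (List.foldl_reverse ..).symm
  cases b <;> simp [length_addBits] <;> omega

end

/-! ### Path sums in weighted graphs -/

/-- Vertices of the product automaton: pairs of states. -/
abbrev Vtx := ℕ × ℕ

/-- Weighted edges: source, target and weight. -/
abbrev Edge (ω : Type) := (Vtx × Vtx) × ω

/-- Arithmetic on representations of numbers that is feasible and lets the length `len` of the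
representations grow slowly. Edge weights come from `ω`, and path sums are in `β`. -/
structure Arith (β ω : Type) [Enc β] [Enc ω] where
  zero : β
  add : β → β → β
  mul : ω → β → β
  len : β → ℕ
  ptime_add : PTime fun p : β × β => add p.1 p.2
  ptime_mul : PTime fun p : ω × β => mul p.1 p.2
  len_zero : len zero ≤ 1
  len_add : ∀ x y, len (add x y) ≤ max (len x) (len y) + 1
  len_mul : ∀ w x, len (mul w x) ≤ len x + esize w
  len_le : ∀ x, len x ≤ esize x
  esize_le : ∀ x, esize x ≤ 12 * len x + 12

/-- The value of a vertex in a table, or `z` if the table has no entry for it. -/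
def lookup {β : Type} (z : β) (t : List (Vtx × β)) (v : Vtx) : β :=
  t.foldl (fun x p => bif p.1 == v then p.2 else x) z

theorem lookup_mem {β : Type} (z : β) (t : List (Vtx × β)) (v : Vtx) :
    lookup z t v = z ∨ ∃ p ∈ t, lookup z t v = p.2 := by
  induction t using List.reverseRecOn with
  | nil => exact .inl rfl
  | append_singleton t p ih =>
    have h : lookup z (t ++ [p]) v = bif p.1 == v then p.2 else lookup z t v := by
      simp [lookup, List.foldl_append]
    rw [h]
    cases p.1 == v
    · refine ih.imp (fun h => h) ?_
      rintro ⟨q, hq, h⟩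
      exact ⟨q, by simp [hq], h⟩
    · exact .inr ⟨p, by simp, rfl⟩

theorem lookup_map {β : Type} (z : β) (vs : List Vtx) (f : Vtx → β) {v : Vtx} (hv : v ∈ vs) :
    lookup z (vs.map fun v => (v, f v)) v = f v := by
  induction vs using List.reverseRecOn with
  | nil => simp at hv
  | append_singleton vs u ih =>
    have h : lookup z ((vs ++ [u]).map fun v => (v, f v)) v =
        bif u == v then f u else lookup z (vs.map fun v => (v, f v)) v := by
      simp [lookup, List.foldl_append]
    rw [h]
    by_cases huv : u = v
    · simp [huv]
    · have : v ∈ vs := by simpa [Ne.symm huv] using hv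
      rw [ih this, beq_false_of_ne huv, cond_false]

namespace Arith

variable {β ω : Type} [Enc β] [Enc ω] (R : Arith β ω)

/-- One step of the computation of path sums: the sum of `x` and of the terms that the edges from
`v` contribute according to the values `f` at their targets. -/
def relax (E : List (Edge ω)) (x : β) (f : Vtx → β) (v : Vtx) : β :=
  E.foldl (fun x e => bif e.1.1 == v then R.add x (R.mul e.2 (f e.1.2)) else x) x

/-- The sum of the weights of all paths of length at most `n` from a vertex, where `init` gives the
weight with which a path may end at a vertex. -/
def pathSum (E : List (Edge ω)) (init : Vtx → β) : ℕ → Vtx → β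
  | 0, v => init v
  | n + 1, v => R.relax E (init v) (pathSum E init n) v

/-- The table of the values of `pathSum` at the vertices `vs`. -/
def table (E : List (Edge ω)) (vs : List Vtx) (init : Vtx → β) (n : ℕ) : List (Vtx × β) :=
  (List.replicate n ()).foldl
    (fun t _ => vs.map fun v => (v, R.relax E (init v) (lookup R.zero t) v))
    (vs.map fun v => (v, init v))

theorem relax_congr {E : List (Edge ω)} {x : β} {f g : Vtx → β} {v : Vtx}
    (h : ∀ e ∈ E, f e.1.2 = g e.1.2) : R.relax E x f v = R.relax E x g v := by
  unfold relax
  refine List.foldl_ext _ _ _ fun x e he => ?_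
  rw [h e he]

theorem table_succ (E : List (Edge ω)) (vs : List Vtx) (init : Vtx → β) (n : ℕ) :
    R.table E vs init (n + 1) =
      vs.map fun v => (v, R.relax E (init v) (lookup R.zero (R.table E vs init n)) v) := by
  rw [table, List.replicate_succ', List.foldl_append]
  rfl

theorem table_eq {E : List (Edge ω)} {vs : List Vtx} (hE : ∀ e ∈ E, e.1.2 ∈ vs)
    (init : Vtx → β) (n : ℕ) :
    R.table E vs init n = vs.map fun v => (v, R.pathSum E init n v) := by
  induction n with
  | zero => rfl
  | succ n ih =>
    rw [table_succ, ih]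
    refine List.map_congr_left fun v _ => ?_
    rw [pathSum, R.relax_congr fun e he => lookup_map _ _ _ (hE e he)]

theorem lookup_table {E : List (Edge ω)} {vs : List Vtx} (hE : ∀ e ∈ E, e.1.2 ∈ vs)
    (init : Vtx → β) (n : ℕ) {v : Vtx} (hv : v ∈ vs) :
    lookup R.zero (R.table E vs init n) v = R.pathSum E init n v := by
  rw [R.table_eq hE, lookup_map _ _ _ hv]

theorem len_relax {E : List (Edge ω)} {x : β} {f : Vtx → β} {v : Vtx} {M W : ℕ}
    (hx : R.len x ≤ M + W) (hf : ∀ e ∈ E, R.len (f e.1.2) ≤ M) (hW : ∀ e ∈ E, esize e ≤ W) :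
    R.len (R.relax E x f v) ≤ M + W + E.length := by
  induction E using List.reverseRecOn with
  | nil => simpa [relax] using hx
  | append_singleton E e ih =>
    have ih' := ih (fun e he => hf e (by simp [he])) (fun e he => hW e (by simp [he]))
    have h : R.relax (E ++ [e]) x f v = bif e.1.1 == v then
        R.add (R.relax E x f v) (R.mul e.2 (f e.1.2)) else R.relax E x f v := by
      simp [relax, List.foldl_append]
    rw [h, List.length_append, List.length_singleton]
    cases e.1.1 == v
    · simp; omega
    · have h₁ := R.len_add (R.relax E x f v) (R.mul e.2 (f e.1.2))
      have h₂ := R.len_mul e.2 (f e.1.2)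
      have h₃ := hf e (by simp)
      have h₄ := hW e (by simp)
      rw [esize_prod] at h₄
      simp only [cond_true]
      omega

theorem len_table {E : List (Edge ω)} {vs : List Vtx} {init : Vtx → β} {I : ℕ} (hI : 1 ≤ I)
    (hinit : ∀ v ∈ vs, R.len (init v) ≤ I) (n : ℕ) : ∀ p ∈ R.table E vs init n,
      R.len p.2 ≤ I + n * (2 * esize E) := by
  induction n with
  | zero =>
    intro p hp
    obtain ⟨v, hv, rfl⟩ := List.mem_map.1 hp
    simpa using hinit v hv
  | succ n ih =>
    intro p hp
    rw [table_succ] at hp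
    obtain ⟨v, hv, rfl⟩ := List.mem_map.1 hp
    refine (R.len_relax (M := I + n * (2 * esize E)) (W := esize E) ?_ (fun e _ => ?_)
      (fun e he => (esize_le_of_mem he).le)).trans ?_
    · have := hinit v hv
      omega
    · rcases lookup_mem R.zero (R.table E vs init n) e.1.2 with h | ⟨q, hq, h⟩
      · rw [h]
        exact R.len_zero.trans (by omega)
      · rw [h]
        exact ih q hq
    · have := length_lt_esize E
      rw [add_mul]
      omega

theorem esize_table_le {E : List (Edge ω)} {vs : List Vtx} {init : Vtx → β} {I : ℕ} (hI : 1 ≤ I)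
    (hinit : ∀ v ∈ vs, R.len (init v) ≤ I) (n : ℕ) : esize (R.table E vs init n) ≤
      esize vs * (esize vs + (12 * (I + n * (2 * esize E)) + 12) + 2) + 1 := by
  have hmem : ∀ p ∈ R.table E vs init n, p.1 ∈ vs := by
    intro p hp
    cases n with
    | zero => obtain ⟨v, hv, rfl⟩ := List.mem_map.1 hp; exact hv
    | succ n => rw [table_succ] at hp; obtain ⟨v, hv, rfl⟩ := List.mem_map.1 hp; exact hv
  have hlen : (R.table E vs init n).length = vs.length := by
    cases n with
    | zero => simp [table]
    | succ n => rw [table_succ, List.length_map]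
  refine (esize_list_le (n := esize vs + (12 * (I + n * (2 * esize E)) + 12) + 1)
    fun p hp => ?_).trans ?_
  · have h₁ := esize_le_of_mem (hmem p hp)
    have h₂ := R.len_table hI hinit n p hp
    have h₃ := R.esize_le p.2
    rw [esize_prod]
    omega
  · rw [hlen]
    gcongr
    exact (length_lt_esize vs).le

end Arith

section

variable {γ β ω : Type} [Enc γ] [Enc β] [Enc ω] [Inhabited β] [Inhabited ω]

@[fun_prop]
theorem PTime.lookup (z : β) {t : γ → List (Vtx × β)} {v : γ → Vtx} (ht : PTime t)
    (hv : PTime v) : PTime fun c => lookup z (t c) (v c) := by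
  refine PTime.foldl (i := fun _ => z)
    (f := fun c x (p : Vtx × β) => bif p.1 == v c then p.2 else x) ht (by fun_prop) (by fun_prop)
    (ht.size.add (.const (esize z))) fun c l' h => ?_
  rcases lookup_mem z l' (v c) with h' | ⟨p, hp, h'⟩
  · exact (congrArg esize h').le.trans (by omega)
  · have h₁ := esize_le_of_mem (h.subset hp)
    rw [esize_prod] at h₁
    exact (congrArg esize h').le.trans (by omega)

/-- Tables of path sums are computable in polynomial time: each of the `n` rounds lengthens the
numbers in the table only by an additive amount. -/
theorem PTime.table (R : Arith β ω) {E : γ → List (Edge ω)} {vs : γ → List Vtx}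
    {init : γ → Vtx → β} {n : γ → ℕ} (hE : PTime E) (hvs : PTime vs)
    (hinit : PTime fun p : γ × Vtx => init p.1 p.2) (hn : PTime n) :
    PTime fun c => R.table (E c) (vs c) (init c) (n c) := by
  have hadd {δ : Type} [Enc δ] {f g : δ → β} (hf : PTime f) (hg : PTime g) :
    PTime fun c => R.add (f c) (g c) := R.ptime_add.comp (hf.prodMk hg)
  have hmul {δ : Type} [Enc δ] {f : δ → ω} {g : δ → β} (hf : PTime f) (hg : PTime g) :
    PTime fun c => R.mul (f c) (g c) := R.ptime_mul.comp (hf.prodMk hg)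
  have hrelax : PTime fun p : (γ × List (Vtx × β)) × Vtx =>
      R.relax (E p.1.1) (init p.1.1 p.2) (PolyTime.lookup R.zero p.1.2) p.2 := by
    have hx : PTime fun p : (γ × List (Vtx × β)) × Vtx => init p.1.1 p.2 :=
      hinit.comp (f := fun p : (γ × List (Vtx × β)) × Vtx => (p.1.1, p.2)) (by fun_prop)
    refine PTime.foldl (f := fun (p : (γ × List (Vtx × β)) × Vtx) x (e : Edge ω) =>
      bif e.1.1 == p.2 then R.add x (R.mul e.2 (PolyTime.lookup R.zero p.1.2 e.1.2)) else x)
      (by fun_prop) hx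
      (PTime.cond (by fun_prop) (hadd (by fun_prop) (hmul (by fun_prop) (by fun_prop)))
        (by fun_prop))
      (s := fun p => 12 * (esize p + 1 + (esize (init p.1.1 p.2) + esize (E p.1.1)) +
        esize (E p.1.1)) + 12)
      (((PBound.const 12).mul (((PBound.size.add (.const 1)).add
        (hx.size.add (hE.size.comp (by fun_prop)))).add
          (hE.size.comp (by fun_prop)))).add (.const 12)) fun p l' h => ?_
    refine (R.esize_le _).trans ?_
    have hlen := (h.length_le.trans (length_lt_esize _).le)
    have := R.len_relax (E := l') (x := init p.1.1 p.2) (f := PolyTime.lookup R.zero p.1.2)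
      (v := p.2) (M := esize p + 1) (W := esize (init p.1.1 p.2) + esize (E p.1.1)) ?_
      (fun e _ => ?_) (fun e he => ?_)
    · unfold Arith.relax at this
      omega
    · have := R.len_le (init p.1.1 p.2)
      omega
    · rcases lookup_mem R.zero p.1.2 e.1.2 with h | ⟨q, hq, h⟩
      · rw [h]
        exact R.len_zero.trans (by omega)
      · rw [h]
        have h₁ := esize_le_of_mem hq
        have h₂ := R.len_le q.2
        rw [esize_prod] at h₁
        rw [esize_prod, esize_prod]
        omega
    · have := esize_le_of_mem (h.subset he)
      omega
  obtain ⟨I, hI, hI'⟩ := PBound.of_mem hvs hinit.size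
  refine PTime.foldl (l := fun c => List.replicate (n c) ())
    (f := fun c t _ => (vs c).map fun v =>
      (v, R.relax (E c) (init c v) (PolyTime.lookup R.zero t) v))
    (by fun_prop)
    (PTime.map (f := fun c v => (v, init c v)) hvs (by fun_prop))
    (PTime.map (γ := γ × List (Vtx × β) × Unit) (l := fun p => vs p.1)
      (f := fun p v => (v, R.relax (E p.1) (init p.1 v) (PolyTime.lookup R.zero p.2.1) v))
      (by fun_prop)
      (PTime.prodMk (by fun_prop) (hrelax.comp
        (f := fun p : (γ × List (Vtx × β) × Unit) × Vtx => ((p.1.1, p.1.2.1), p.2))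
        (by fun_prop))))
    (s := fun c => esize (vs c) *
      (esize (vs c) + (12 * ((I c + 1) + esize (n c) * (2 * esize (E c))) + 12) + 2) + 1)
    ((hvs.size.mul ((hvs.size.add (((PBound.const 12).mul ((hI.add (.const 1)).add
      (hn.size.mul ((PBound.const 2).mul hE.size)))).add (.const 12))).add (.const 2))).add
        (.const 1)) fun c l' h => ?_
  obtain ⟨k, hk, rfl⟩ : ∃ k ≤ n c, l' = List.replicate k () :=
    ⟨l'.length, by simpa using h.length_le, List.eq_replicate_of_mem fun _ _ => rfl⟩
  refine (R.esize_table_le (I := I c + 1) (by omega) (fun v hv => ?_) k).trans ?_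
  · exact ((R.len_le _).trans (hI' c v hv)).trans (by omega)
  · gcongr
    rw [esize_nat]
    omega

end

/-! ### The decision procedure -/

/-- Arithmetic for counting paths: the weights of the edges are ignored. -/
def countArith : Arith (List Bool) (List Bool × List Bool) where
  zero := []
  add := addBits
  mul _ x := x
  len := List.length
  ptime_add := by fun_prop
  ptime_mul := by fun_prop
  len_zero := by simp
  len_add x y := (length_addBits x y).le
  len_mul _ _ := by simp
  len_le x := (length_lt_esize x).le
  esize_le x := by simp; omega

/-- Comparison of fractions, given as numerator and denominator. -/
def leFrac (x y : List Bool × List Bool) : Bool :=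
  leBits (mulBits x.1 y.2) (mulBits y.1 x.2)

@[fun_prop]
theorem PTime.leFrac {γ : Type} [Enc γ] {x y : γ → List Bool × List Bool} (hx : PTime x)
    (hy : PTime y) : PTime fun c => leFrac (x c) (y c) := by
  unfold PolyTime.leFrac
  fun_prop

/-- Arithmetic of fractions for computing maximal path weights: the sum is the maximum. -/
def maxArith : Arith (List Bool × List Bool) (List Bool × List Bool) where
  zero := ([], [true])
  add x y := bif leFrac x y then y else x
  mul w x := (mulBits w.1 x.1, mulBits w.2 x.2)
  len x := max x.1.length x.2.length
  ptime_add := by fun_prop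
  ptime_mul := by fun_prop
  len_zero := by simp
  len_add x y := by cases leFrac x y <;> simp <;> omega
  len_mul w x := by
    have h₁ := length_mulBits w.1 x.1
    have h₂ := length_mulBits w.2 x.2
    simp
    omega
  len_le x := by simp; omega
  esize_le x := by simp; omega

/-- Split a string of separators `(true, _)` and bits `(false, b)` at the separators. The result
consists of the first part and the list of the other ones. -/
def splitSep (l : List (Bool × Bool)) : List Bool × List (List Bool) :=
  l.foldr (fun g s => bif g.1 then ([], s.1 :: s.2) else (g.2 :: s.1, s.2)) ([], [])

@[fun_prop]
theorem PTime.splitSep {γ : Type} [Enc γ] {l : γ → List (Bool × Bool)} (hl : PTime l) :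
    PTime fun c => splitSep (l c) := by
  refine PTime.congr (PTime.foldl_of_add (l := fun c => (l c).reverse) (i := fun _ => ([], []))
    (f := fun _ (s : List Bool × List (List Bool)) (g : Bool × Bool) =>
      bif g.1 then ([], s.1 :: s.2) else (g.2 :: s.1, s.2)) (by fun_prop) (by fun_prop)
      (by fun_prop) (.const 6) fun c s g _ => ?_) fun c => List.foldl_reverse.symm
  cases g.1 <;> simp <;> omega

/-- Transitions: letter, source and target, and the weight as numerator and denominator. -/
abbrev Trans := (ℕ × ℕ × ℕ) × List Bool × List Bool

/-- Distribute a list of numbers, two at a time, to the elements of a list. -/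
def assignPairs : List (ℕ × ℕ × ℕ) → List (List Bool) → List Trans
  | [], _ => []
  | t :: ts, ns => (t, ns.headD [], ns.tail.headD []) :: assignPairs ts ns.tail.tail

theorem esize_headD_add_tail {α : Type} [Enc α] (l : List α) (a : α) :
    esize (l.headD a) + esize l.tail ≤ esize l + esize a := by
  cases l <;> simp; omega

@[fun_prop]
theorem PTime.assignPairs {γ : Type} [Enc γ] {ts : γ → List (ℕ × ℕ × ℕ)}
    {ns : γ → List (List Bool)} (hts : PTime ts) (hns : PTime ns) :
    PTime fun c => assignPairs (ts c) (ns c) := by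
  let f : List (List Bool) × List Trans → ℕ × ℕ × ℕ → List (List Bool) × List Trans := fun s t =>
    (s.1.tail.tail, (t, s.1.headD [], s.1.tail.headD []) :: s.2)
  have h : PTime fun c => (ts c).foldl f (ns c, []) := by
    refine PTime.foldl_of_add (f := fun _ => f) hts (by fun_prop) (by fun_prop)
      (hts.size.add (.const 10)) fun c s t ht => ?_
    have h₁ := esize_headD_add_tail s.1 []
    have h₂ := esize_headD_add_tail s.1.tail []
    have h₃ := esize_le_of_mem ht
    simp only [f, esize_prod, esize_cons, esize_nil] at *
    omega
  refine PTime.congr h.snd.reverse fun c => ?_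
  have key (ts : List (ℕ × ℕ × ℕ)) : ∀ (ns : List (List Bool)) (acc : List Trans),
      acc.reverse ++ PolyTime.assignPairs ts ns = (ts.foldl f (ns, acc)).2.reverse := by
    induction ts with
    | nil => intro ns acc; simp [PolyTime.assignPairs]
    | cons t ts ih => intro ns acc; rw [List.foldl_cons, ← ih]; simp [PolyTime.assignPairs]
  exact key _ _ []

/-- All pairs of states. -/
def vertices (m : ℕ) : List Vtx :=
  (List.range m).flatMap fun q => (List.range m).map fun r => (q, r)

@[fun_prop]
theorem PTime.vertices {γ : Type} [Enc γ] {m : γ → ℕ} (hm : PTime m) :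
    PTime fun c => vertices (m c) :=
  PTime.flatMap (f := fun c q => (List.range (m c)).map fun r => (q, r)) (by fun_prop)
    (PTime.map (γ := γ × ℕ) (l := fun p => List.range (m p.1)) (f := fun p r => (p.2, r))
      (by fun_prop) (by fun_prop))

/-- All triples of a letter and two states. -/
def triples (k m : ℕ) : List (ℕ × ℕ × ℕ) :=
  (List.range k).flatMap fun a => (vertices m).map fun v => (a, v)

@[fun_prop]
theorem PTime.triples {γ : Type} [Enc γ] {k m : γ → ℕ} (hk : PTime k) (hm : PTime m) :
    PTime fun c => triples (k c) (m c) :=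
  PTime.flatMap (f := fun c a => (PolyTime.vertices (m c)).map fun v => (a, v)) (by fun_prop)
    (PTime.map (γ := γ × ℕ) (l := fun p => PolyTime.vertices (m p.1)) (f := fun p v => (p.2, v))
      (by fun_prop) (by fun_prop))

/-- An input of the problem after parsing: the number of states, the two states to be compared, a
list of bits that tell which states are final, and the transitions. -/
abbrev ParsedInput := (ℕ × ℕ × ℕ) × List Bool × List Trans

/-- Parse an input string. As there is no separator between the bits for the final states and the
first numerator, the number of states is needed to tell them apart. -/
def parse (l : List (Bool × Bool)) : ParsedInput :=
  let s := splitSep l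
  ((s.1.length, (s.2.tail.headD []).length, (s.2.tail.tail.headD []).length),
    s.2.tail.tail.tail.headD [],
    assignPairs (triples (s.2.headD []).length s.1.length)
      ((s.2.tail.tail.tail.headD []).drop s.1.length :: s.2.tail.tail.tail.tail))

theorem PTime.parse : PTime parse := by
  unfold PolyTime.parse
  fun_prop

/-- Whether two transitions have the same letter and non-zero weights. -/
def compatible (t t' : Trans) : Bool :=
  t.1.1 == t'.1.1 && !t.2.1.isEmpty && !t'.2.1.isEmpty

/-- The edge of the product automaton for a pair of transitions. Its weight is the quotient of the
weights of the two transitions. -/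
def prodEdge (t t' : Trans) : Edge (List Bool × List Bool) :=
  (((t.1.2.1, t'.1.2.1), (t.1.2.2, t'.1.2.2)), (mulBits t.2.1 t'.2.2, mulBits t.2.2 t'.2.1))

/-- The edges of the product automaton. -/
def prodEdges (T : List Trans) : List (Edge (List Bool × List Bool)) :=
  T.flatMap fun t => (T.filter (compatible t)).map (prodEdge t)

@[fun_prop]
theorem PTime.prodEdges {γ : Type} [Enc γ] {T : γ → List Trans} (hT : PTime T) :
    PTime fun c => prodEdges (T c) := by
  have h₁ : PTime fun p : Trans × Trans => compatible p.1 p.2 := by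
    unfold compatible
    fun_prop
  have h₂ : PTime fun p : Trans × Trans => prodEdge p.1 p.2 := by
    unfold prodEdge
    fun_prop
  exact PTime.flatMap (f := fun c t => ((T c).filter (compatible t)).map (prodEdge t)) hT
    (PTime.map (γ := γ × Trans) (l := fun p => (T p.1).filter (compatible p.2))
      (f := fun p => prodEdge p.2) (PTime.filter (f := fun (p : γ × Trans) => compatible p.2)
        (by fun_prop)
        (h₁.comp (f := fun p : (γ × Trans) × Trans => (p.1.2, p.2)) (by fun_prop)))
      (h₂.comp (f := fun p : (γ × Trans) × Trans => (p.1.2, p.2)) (by fun_prop)))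

/-- Whether both states of a pair are final. -/
def bothFinal (fin : List Bool) (v : Vtx) : Bool :=
  (fin.drop v.1).headD false && (fin.drop v.2).headD false

@[fun_prop]
theorem PTime.bothFinal {γ : Type} [Enc γ] {fin : γ → List Bool} {v : γ → Vtx} (hf : PTime fin)
    (hv : PTime v) : PTime fun c => bothFinal (fin c) (v c) := by
  unfold PolyTime.bothFinal
  fun_prop

/-- The number of pairs of accepting paths with the same label of length at most `m²`, for all
pairs of states at which they may start. -/
def countTable (I : ParsedInput) : List (Vtx × List Bool) :=
  countArith.table (prodEdges I.2.2) (vertices I.1.1)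
    (fun v => bif bothFinal I.2.1 v then [true] else []) (vertices I.1.1).length

/-- For every vertex, the number of paths of length at most `m²` that lead there from the pair of
the two states to be compared. -/
def reachTable (I : ParsedInput) : List (Vtx × List Bool) :=
  countArith.table ((prodEdges I.2.2).map fun e => ((e.1.2, e.1.1), e.2)) (vertices I.1.1)
    (fun v => bif v == (I.1.2.1, I.1.2.2) then [true] else []) (vertices I.1.1).length

/-- For every vertex, the maximal weight of an accepting path of length at most `m² + i`. -/
def maxTable (I : ParsedInput) (i : ℕ) : List (Vtx × (List Bool × List Bool)) :=
  maxArith.table (prodEdges I.2.2) (vertices I.1.1)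
    (fun v => bif bothFinal I.2.1 v then ([true], [true]) else ([], [true]))
    ((vertices I.1.1).length + i)

/-- The inclusion test: every word accepted from the first state is accepted from the second. -/
def inclusionTest (I : ParsedInput) : Bool :=
  leBits (lookup [] (countTable I) (I.1.2.1, I.1.2.1)) (lookup [] (countTable I) (I.1.2.1, I.1.2.2))

/-- The stability test: at the reachable vertices, the maximal weights of accepting paths do not
grow any more when the bound on the length exceeds `m²`. -/
def stabilityTest (I : ParsedInput) : Bool :=
  (vertices I.1.1).all fun v => leBits (lookup [] (reachTable I) v) [] ||
    leFrac (lookup maxArith.zero (maxTable I 1) v) (lookup maxArith.zero (maxTable I 0) v)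

/-- The decision procedure. -/
def decideBigO (I : ParsedInput) : Bool := inclusionTest I && stabilityTest I

theorem PTime.countTable : PTime countTable :=
  PTime.table countArith (init := fun (I : ParsedInput) v =>
    bif PolyTime.bothFinal I.2.1 v then [true] else []) (by fun_prop) (by fun_prop) (by fun_prop)
    (by fun_prop)

theorem PTime.reachTable : PTime reachTable :=
  PTime.table countArith (init := fun (I : ParsedInput) v =>
    bif v == (I.1.2.1, I.1.2.2) then [true] else [])
    (PTime.map (f := fun _ (e : Edge (List Bool × List Bool)) => ((e.1.2, e.1.1), e.2))
      (by fun_prop) (by fun_prop)) (by fun_prop) (by fun_prop) (by fun_prop)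

theorem PTime.maxTable (i : ℕ) : PTime fun I => maxTable I i := by
  refine PTime.table maxArith (init := fun (I : ParsedInput) v =>
    bif PolyTime.bothFinal I.2.1 v then ([true], [true]) else ([], [true])) (by fun_prop)
    (by fun_prop) (by fun_prop) ?_
  induction i with
  | zero => exact PTime.length (by fun_prop)
  | succ i ih => exact ih.succ

theorem PTime.inclusionTest : PTime inclusionTest :=
  PTime.leBits (.lookup _ .countTable (by fun_prop)) (.lookup _ .countTable (by fun_prop))

theorem PTime.stabilityTest : PTime stabilityTest := by
  have h₁ : PTime fun p : ParsedInput × Vtx => PolyTime.reachTable p.1 :=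
    PTime.reachTable.comp (by fun_prop)
  have h₂ (i : ℕ) : PTime fun p : ParsedInput × Vtx => PolyTime.maxTable p.1 i :=
    (PTime.maxTable i).comp (by fun_prop)
  exact PTime.all (f := fun (I : ParsedInput) v =>
    PolyTime.leBits (PolyTime.lookup [] (PolyTime.reachTable I) v) [] ||
    PolyTime.leFrac (PolyTime.lookup maxArith.zero (PolyTime.maxTable I 1) v)
      (PolyTime.lookup maxArith.zero (PolyTime.maxTable I 0) v))
    (by fun_prop) (by fun_prop)

theorem PTime.decideBigO : PTime decideBigO :=
  PTime.and .inclusionTest .stabilityTest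

/-- Input symbols as separators or bits. -/
def symbol : Γ' → Bool × Bool
  | .bit b => (false, b)
  | .comma => (true, false)
  | _ => (false, false)

/-- The correctness of `decideBigO` implies that the problem is decidable in polynomial time. -/
theorem decidableInPolyTimeOn_of_decideBigO {α : Type} {enc : α → List Γ'} {promise q : α → Prop}
    (h : ∀ x, promise x → (decideBigO (parse ((enc x).map symbol)) = true ↔ q x)) :
    DecidableInPolyTimeOn enc promise q := by
  have hf : PTime fun l : List (Bool × Bool) => decideBigO (parse l.reverse) :=
    PTime.decideBigO.comp (PTime.parse.comp (by fun_prop))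
  refine hf.decidableInPolyTimeOn symbol fun x hx => ?_
  simpa using h x hx

/-! ### Correctness of the parser -/

theorem splitSep_bits_append (x : List Bool) (l : List (Bool × Bool)) :
    splitSep (x.map (fun b => (false, b)) ++ l) = (x ++ (splitSep l).1, (splitSep l).2) := by
  induction x with
  | nil => rfl
  | cons b x ih =>
    have h : splitSep ((b :: x).map (fun b => (false, b)) ++ l) =
      (b :: (splitSep (x.map (fun b => (false, b)) ++ l)).1,
        (splitSep (x.map (fun b => (false, b)) ++ l)).2) := rfl
    rw [h, ih]
    rfl

theorem splitSep_sep (l : List (Bool × Bool)) :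
    splitSep ((true, false) :: l) = ([], (splitSep l).1 :: (splitSep l).2) := rfl

theorem map_symbol_encodeBinary (n : ℕ) : (BigOInput.encodeBinary n).map symbol =
    (Computability.encodeNat n).map (fun b => (false, b)) ++ [(true, false)] := by
  simp [BigOInput.encodeBinary, symbol, Function.comp_def]

theorem map_symbol_encodeUnary (n : ℕ) : (BigOInput.encodeUnary n).map symbol =
    (List.replicate n true).map (fun b => (false, b)) ++ [(true, false)] := by
  simp [BigOInput.encodeUnary, symbol]

theorem splitSep_encodeBinary (N : List ℕ) :
    (splitSep ((N.flatMap BigOInput.encodeBinary).map symbol)).1 ::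
      (splitSep ((N.flatMap BigOInput.encodeBinary).map symbol)).2 =
    N.map Computability.encodeNat ++ [[]] := by
  induction N with
  | nil => rfl
  | cons n N ih =>
    rw [List.flatMap_cons, List.map_append, map_symbol_encodeBinary, List.append_assoc,
      splitSep_bits_append]
    simp [splitSep_sep, ih]

theorem assignPairs_flatMap {τ : Type} (L : List τ) (g : τ → ℕ × ℕ × ℕ) (n d : τ → List Bool)
    (rest : List (List Bool)) :
    assignPairs (L.map g) ((L.flatMap fun x => [n x, d x]) ++ rest) =
      L.map fun x => (g x, n x, d x) := by
  induction L with
  | nil => rfl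
  | cons x L ih => simpa [assignPairs] using ih

/-- All triples of a letter and two states of the input. -/
def finTriples (I : BigOInput) :
    List (Fin I.numLetters × Fin I.numStates × Fin I.numStates) :=
  (List.finRange I.numLetters).flatMap fun a => (List.finRange I.numStates).flatMap fun q =>
    (List.finRange I.numStates).map fun r => (a, q, r)

/-- The transition of the input with the given letter, source and target. -/
def transition (I : BigOInput) (x : Fin I.numLetters × Fin I.numStates × Fin I.numStates) : Trans :=
  ((x.1, x.2.1, x.2.2), Computability.encodeNat (I.num x.1 x.2.1 x.2.2),
    Computability.encodeNat (I.den x.1 x.2.1 x.2.2))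

theorem map_finTriples (I : BigOInput) :
    (finTriples I).map (fun x => ((x.1 : ℕ), (x.2.1 : ℕ), (x.2.2 : ℕ))) =
      triples I.numLetters I.numStates := by
  simp only [finTriples, triples, vertices, ← List.map_coe_finRange_eq_range, List.map_flatMap,
    List.flatMap_map, List.map_map, Function.comp_def]

/-- The parser recovers the input. The bits for the final states are followed by the digits `rest`
of the first numerator. -/
theorem parse_encode (I : BigOInput) : ∃ rest, parse (I.encode.map symbol) =
    ((I.numStates, (I.s : ℕ), (I.s' : ℕ)),
      (List.finRange I.numStates).map (fun q => decide (q ∈ I.final)) ++ rest,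
      (finTriples I).map (transition I)) := by
  set N := (finTriples I).flatMap fun x =>
    [I.num x.1 x.2.1 x.2.2, I.den x.1 x.2.1 x.2.2] with hN
  have hbody : ((List.finRange I.numLetters).flatMap fun a =>
      (List.finRange I.numStates).flatMap fun q => (List.finRange I.numStates).flatMap fun q' =>
        BigOInput.encodeBinary (I.num a q q') ++ BigOInput.encodeBinary (I.den a q q')) =
      N.flatMap BigOInput.encodeBinary := by
    simp [hN, finTriples, List.flatMap_assoc, List.flatMap_map, List.flatMap_cons]
  set fin := (List.finRange I.numStates).map (fun q => decide (q ∈ I.final)) with hfin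
  have hfin' : ((List.finRange I.numStates).map (fun q => Γ'.bit (decide (q ∈ I.final)))).map
      symbol = fin.map fun b => (false, b) := by
    simp [hfin, symbol, Function.comp_def]
  have hsplit := splitSep_encodeBinary N
  set S := splitSep ((N.flatMap BigOInput.encodeBinary).map symbol) with hS
  have key : splitSep (I.encode.map symbol) = (List.replicate I.numStates true,
      [List.replicate I.numLetters true, List.replicate I.s true, List.replicate I.s' true,
        fin ++ S.1] ++ S.2) := by
    rw [BigOInput.encode, hbody]
    simp only [List.map_append, map_symbol_encodeUnary, hfin', List.append_assoc,
      splitSep_bits_append, List.cons_append, List.nil_append, splitSep_sep, ← hS,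
      List.append_nil]
  refine ⟨S.1, ?_⟩
  have hdrop : (fin ++ S.1).drop I.numStates = S.1 := by
    rw [List.drop_append_of_le_length (by simp [hfin])]
    simp [hfin]
  have hN' : N.map Computability.encodeNat = (finTriples I).flatMap fun x =>
      [Computability.encodeNat (I.num x.1 x.2.1 x.2.2),
        Computability.encodeNat (I.den x.1 x.2.1 x.2.2)] := by
    simp [hN, List.map_flatMap]
  simp only [parse, key, List.cons_append, List.nil_append, List.tail_cons, List.headD_cons,
    List.length_replicate, hdrop, hsplit, hN', ← map_finTriples]
  rw [assignPairs_flatMap]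
  rfl

end PolyTime

/-! ### Unambiguous automata -/

namespace WeightedAutomaton

variable {Q S : Type} [Fintype Q] [DecidableEq Q] (A : WeightedAutomaton Q S)

theorem wordWeight_nil (q : Q) : A.wordWeight q [] = if q ∈ A.final then 1 else 0 := by
  simp [wordWeight, Matrix.one_apply]

theorem wordWeight_cons (q : Q) (a : S) (w : List S) :
    A.wordWeight q (a :: w) = ∑ r, A.weight a q r * A.wordWeight r w := by
  simp only [wordWeight, List.map_cons, List.prod_cons, Matrix.mul_apply, Finset.mul_sum]
  exact Finset.sum_comm

theorem wordWeight_nonneg (q : Q) (w : List S) : 0 ≤ A.wordWeight q w := by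
  induction w generalizing q with
  | nil => rw [wordWeight_nil]; split <;> simp
  | cons a w ih =>
    rw [wordWeight_cons]
    exact Finset.sum_nonneg fun r _ => mul_nonneg (A.weight_nonneg a q r) (ih r)

theorem le_wordWeight_cons (q r : Q) (a : S) (w : List S) :
    A.weight a q r * A.wordWeight r w ≤ A.wordWeight q (a :: w) := by
  rw [wordWeight_cons]
  exact Finset.single_le_sum (f := fun r => A.weight a q r * A.wordWeight r w)
    (fun r _ => mul_nonneg (A.weight_nonneg a q r) (A.wordWeight_nonneg r w)) (Finset.mem_univ r)

/-- The number of accepting paths on a word from a state. -/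
def pathCount : Q → List S → ℕ
  | q, [] => if q ∈ A.final then 1 else 0
  | q, a :: w => ∑ r, if 0 < A.weight a q r then pathCount r w else 0

variable {A}

theorem pathCount_pos {q : Q} {w : List S} : 0 < A.pathCount q w ↔ 0 < A.wordWeight q w := by
  induction w generalizing q with
  | nil => rw [wordWeight_nil, pathCount]; split <;> simp
  | cons a w ih =>
    rw [wordWeight_cons, pathCount, Finset.sum_pos_iff, Finset.sum_pos_iff_of_nonneg fun r _ =>
      mul_nonneg (A.weight_nonneg a q r) (A.wordWeight_nonneg r w)]
    refine exists_congr fun r => and_congr_right fun _ => ?_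
    by_cases h : 0 < A.weight a q r
    · simp [h, ih]
    · simp [le_antisymm (not_lt.1 h) (A.weight_nonneg a q r)]

theorem pathCount_le_cons {q r : Q} {a : S} (h : 0 < A.weight a q r) (w : List S) :
    A.pathCount r w ≤ A.pathCount q (a :: w) := by
  rw [pathCount]
  have := Finset.single_le_sum (f := fun r => if 0 < A.weight a q r then A.pathCount r w else 0)
    (fun _ _ => Nat.zero_le _) (Finset.mem_univ r)
  simpa [h] using this

theorem nonempty_path_of_pathCount_pos (s : Q) {q : Q} {w : List S} (h : 0 < A.pathCount q w) :
    Nonempty (Σ t : {t : Q // t ∈ (A.toNFA s).accept}, (A.toNFA s).Path q t.1 w) := by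
  induction w generalizing q with
  | nil =>
    have : q ∈ A.final := by
      by_contra hq
      simp [pathCount, hq] at h
    exact ⟨⟨⟨q, this⟩, .nil q⟩⟩
  | cons a w ih =>
    rw [pathCount, Finset.sum_pos_iff] at h
    obtain ⟨r, -, hr⟩ := h
    by_cases hw : 0 < A.weight a q r
    · obtain ⟨t, p⟩ := ih (q := r) (by simpa [hw] using hr)
      exact ⟨t, .cons r q _ a w hw p⟩
    · simp [hw] at hr

theorem pathCount_le_one (s : Q) {q : Q} {w : List S}
    (h : Subsingleton (Σ t : {t : Q // t ∈ (A.toNFA s).accept}, (A.toNFA s).Path q t.1 w)) :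
    A.pathCount q w ≤ 1 := by
  induction w generalizing q with
  | nil => rw [pathCount]; split <;> simp
  | cons a w ih =>
    rw [pathCount]
    by_cases hr : ∃ r, 0 < A.weight a q r ∧ 0 < A.pathCount r w
    · obtain ⟨r, hr, hp⟩ := hr
      rw [Finset.sum_eq_single r]
      · rw [if_pos hr]
        refine ih ⟨fun ⟨t, p⟩ ⟨t', p'⟩ => ?_⟩
        have := h.elim ⟨t, .cons r q _ a w hr p⟩ ⟨t', .cons r q _ a w hr p'⟩
        simp only [Sigma.mk.injEq] at this
        obtain ⟨rfl, e⟩ := this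
        injection eq_of_heq e with _ _ _ _ _ e
        rw [e]
      · intro r' _ hne
        by_contra h0
        have hr' : 0 < A.weight a q r' := by
          by_contra hw
          simp [hw] at h0
        rw [if_pos hr'] at h0
        obtain ⟨t, p⟩ := nonempty_path_of_pathCount_pos s hp
        obtain ⟨t', p'⟩ := nonempty_path_of_pathCount_pos s (Nat.pos_of_ne_zero h0)
        have := h.elim ⟨t, .cons r q _ a w hr p⟩ ⟨t', .cons r' q _ a w hr' p'⟩
        simp only [Sigma.mk.injEq] at this
        obtain ⟨rfl, e⟩ := this
        injection eq_of_heq e with e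
        exact hne e.symm
      · simp
    · rw [Finset.sum_eq_zero]
      · simp
      · intro r _
        by_contra h0
        refine hr ⟨r, ?_⟩
        by_cases hw : 0 < A.weight a q r
        · exact ⟨hw, by simpa [hw, Nat.pos_iff_ne_zero] using h0⟩
        · simp [hw] at h0

/-- Unambiguity in terms of the number of accepting paths. -/
def Unambiguous (A : WeightedAutomaton Q S) (q : Q) : Prop := ∀ w, A.pathCount q w ≤ 1

theorem UnambiguousFrom.unambiguous {s : Q} (h : A.UnambiguousFrom s) : A.Unambiguous s :=
  fun w => pathCount_le_one s (h w)

theorem Unambiguous.of_weight_pos {q r : Q} (h : A.Unambiguous q) {a : S}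
    (hr : 0 < A.weight a q r) : A.Unambiguous r :=
  fun w => (pathCount_le_cons hr w).trans (h _)

theorem Unambiguous.wordWeight_cons {q r : Q} (h : A.Unambiguous q) {a : S} {w : List S}
    (hr : 0 < A.weight a q r) (hw : 0 < A.wordWeight r w) :
    A.wordWeight q (a :: w) = A.weight a q r * A.wordWeight r w := by
  rw [WeightedAutomaton.wordWeight_cons, Finset.sum_eq_single r _ (by simp)]
  intro r' _ hne
  by_contra h0
  have h₁ : 0 < A.weight a q r' :=
    lt_of_le_of_ne (A.weight_nonneg a q r') fun h => h0 (by rw [← h, zero_mul])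
  have h₂ : 0 < A.wordWeight r' w :=
    lt_of_le_of_ne (A.wordWeight_nonneg r' w) fun h => h0 (by rw [← h, mul_zero])
  have h₃ := h (a :: w)
  rw [pathCount] at h₃
  have h₄ := Finset.add_le_sum (f := fun r => if 0 < A.weight a q r then A.pathCount r w else 0)
    (fun _ _ => Nat.zero_le _) (Finset.mem_univ r) (Finset.mem_univ r') hne.symm
  simp only [hr, h₁, if_true] at h₄
  have h₅ := pathCount_pos.2 hw
  have h₆ := pathCount_pos.2 h₂
  omega

end WeightedAutomaton

/-! ### Stabilisation of counts and maxima -/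

section stabilisation

variable {V : Type} [Fintype V]

/-- If `∑ v, u v * (M ^ i x) v` vanishes for all `i` below the dimension, then it vanishes for all
`i`, because `M ^ i` is a linear combination of lower powers by the theorem of Cayley and
Hamilton. -/
theorem Matrix.dotProduct_pow_mulVec_eq_zero [DecidableEq V] (M : Matrix V V ℚ) (u x : V → ℚ)
    (h : ∀ i < Fintype.card V, u ⬝ᵥ (M ^ i).mulVec x = 0) (i : ℕ) :
    u ⬝ᵥ (M ^ i).mulVec x = 0 := by
  by_cases hV : Nonempty V
  · rw [Matrix.pow_eq_aeval_mod_charpoly, Polynomial.aeval_eq_sum_range, Matrix.sum_mulVec,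
      dotProduct_sum]
    refine Finset.sum_eq_zero fun j hj => ?_
    have hdeg : (Polynomial.X ^ i %ₘ M.charpoly).natDegree < Fintype.card V := by
      rw [← M.charpoly_natDegree_eq_dim]
      refine Polynomial.natDegree_modByMonic_lt _ M.charpoly_monic fun h1 => ?_
      have := M.charpoly_natDegree_eq_dim
      rw [h1, Polynomial.natDegree_one] at this
      exact Fintype.card_ne_zero this.symm
    rw [Matrix.smul_mulVec, dotProduct_smul, h j (by have := Finset.mem_range.1 hj; omega),
      smul_zero]
  · have := not_nonempty_iff.1 hV
    simp

/-- An increasing sequence of sets of vertices that is constant once it has two equal consecutive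
members is constant from the number of vertices on. -/
theorem Finset.eq_of_stable {f : ℕ → Finset V} (hf : Monotone f)
    (h : ∀ n, f (n + 1) = f n → f (n + 2) = f (n + 1)) {n : ℕ} (hn : Fintype.card V ≤ n) :
    f n = f (Fintype.card V) := by
  have hcard := Nat.stabilises_of_monotone (f := fun n => (f n).card) (b := Fintype.card V)
    (fun i j hij => Finset.card_le_card (hf hij)) (fun n => Finset.card_le_univ _)
    (fun m hm => by
      have := Finset.eq_of_subset_of_card_le (hf (Nat.le_succ m)) hm.ge
      exact congrArg Finset.card (h m this.symm).symm) hn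
  exact (Finset.eq_of_subset_of_card_le (hf hn) hcard.le).symm

/-- The vertices that are reachable in at most `card V` steps are all the reachable ones. -/
theorem mem_of_reachable {R : V → V → Prop} {s : V} {f : ℕ → Finset V}
    (h0 : ∀ v, v ∈ f 0 ↔ v = s)
    (h1 : ∀ n v, v ∈ f (n + 1) ↔ v = s ∨ ∃ u ∈ f n, R u v) (v : V) :
    v ∈ f (Fintype.card V) ↔ Relation.ReflTransGen R s v := by
  have hsucc (n : ℕ) : f n ⊆ f (n + 1) := by
    induction n with
    | zero => intro v hv; exact (h1 0 v).2 (.inl ((h0 v).1 hv))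
    | succ n ih =>
      intro v hv
      rcases (h1 n v).1 hv with h | ⟨u, hu, huv⟩
      · exact (h1 _ v).2 (.inl h)
      · exact (h1 _ v).2 (.inr ⟨u, ih hu, huv⟩)
  have hmono : Monotone f := monotone_nat_of_le_succ hsucc
  constructor
  · generalize Fintype.card V = n
    intro hv
    induction n generalizing v with
    | zero => rw [(h0 v).1 hv]
    | succ n ih =>
      rcases (h1 n v).1 hv with rfl | ⟨u, hu, huv⟩
      · exact .refl
      · exact (ih u hu).tail huv
  · intro h
    have : ∃ n, v ∈ f n := by
      induction h with
      | refl => exact ⟨0, (h0 s).2 rfl⟩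
      | tail _ huv ih =>
        obtain ⟨n, hn⟩ := ih
        exact ⟨n + 1, (h1 n _).2 (.inr ⟨_, hn, huv⟩)⟩
    obtain ⟨n, hn⟩ := this
    rcases le_total n (Fintype.card V) with hle | hle
    · exact hmono hle hn
    · rwa [Finset.eq_of_stable hmono (fun n e => ?_) hle] at hn
      ext v
      rw [h1, h1, e]

/-- The sequence `d n v` of the maximal weights of accepting paths of length at most `n` from `v`,
characterised by its recursion. Paths may end at `v` with weight `init v`, and `E v u ρ` means that
there is an edge from `v` to `u` of weight `ρ`. -/
structure IsMaxWeight {V : Type} (E : V → V → ℝ → Prop) (init : V → ℝ) (d : ℕ → V → ℝ) :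
    Prop where
  zero : ∀ v, d 0 v = init v
  init_le : ∀ n v, init v ≤ d (n + 1) v
  edge_le : ∀ n v u ρ, E v u ρ → ρ * d n u ≤ d (n + 1) v
  eq_or : ∀ n v, d (n + 1) v = init v ∨ ∃ u ρ, E v u ρ ∧ d (n + 1) v = ρ * d n u

namespace IsMaxWeight

variable {V : Type} {E : V → V → ℝ → Prop} {init : V → ℝ} {d : ℕ → V → ℝ}

theorem mono (h : IsMaxWeight E init d) (hE : ∀ v u ρ, E v u ρ → 0 < ρ) (v : V) :
    Monotone fun n => d n v := by
  refine monotone_nat_of_le_succ fun n => ?_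
  induction n generalizing v with
  | zero => rw [h.zero]; exact h.init_le 0 v
  | succ n ih =>
    rcases h.eq_or n v with e | ⟨u, ρ, hu, e⟩
    · rw [e]; exact h.init_le _ v
    · rw [e]
      exact (mul_le_mul_of_nonneg_left (ih u) (hE _ _ _ hu).le).trans (h.edge_le _ _ _ _ hu)

/-- If the weights of all accepting paths are bounded, then the maximal ones are attained by paths
whose length is at most the number of vertices. Let `D v` be the supremum. If the set of
vertices where `D` is attained within `n` steps is the same for `n + 1`, then every path from a
vertex `v` outside this set loses a constant factor compared with `D v` on the way into this set,
so that it contains all vertices. -/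
theorem stable [Fintype V] (h : IsMaxWeight E init d) (hE : ∀ v u ρ, E v u ρ → 0 < ρ)
    (hinit : ∀ v, 0 ≤ init v) (hbdd : ∀ v, ∃ C, ∀ n, d n v ≤ C) (n : ℕ) (v : V) :
    d n v ≤ d (Fintype.card V) v := by
  classical
  have hmono := h.mono hE
  have hnonneg (n : ℕ) (v : V) : 0 ≤ d n v :=
    (hinit v).trans ((h.zero v).ge.trans (hmono v (Nat.zero_le n)))
  set D : V → ℝ := fun v => ⨆ n, d n v with hD
  have hBA (v : V) : BddAbove (Set.range fun n => d n v) := by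
    obtain ⟨C, hC⟩ := hbdd v
    exact ⟨C, by rintro _ ⟨n, rfl⟩; exact hC n⟩
  have hle (n : ℕ) (v : V) : d n v ≤ D v := le_ciSup (hBA v) n
  let U : ℕ → Finset V := fun n => Finset.univ.filter fun v => d n v = D v
  have hU (n : ℕ) (v : V) : v ∈ U n ↔ d n v = D v := by simp [U]
  have hUmono : Monotone U := by
    intro i j hij v hv
    rw [hU] at hv ⊢
    exact le_antisymm (hle j v) (hv ▸ hmono v hij)
  have huniv (n : ℕ) (hn : U (n + 1) = U n) : U n = Finset.univ := by
    by_contra hne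
    obtain ⟨v₀, hv₀⟩ : (U n)ᶜ.Nonempty := by
      rwa [Finset.nonempty_iff_ne_empty, ne_eq, Finset.compl_eq_empty_iff]
    obtain ⟨v₁, hv₁, hmax⟩ := Finset.exists_max_image (U n)ᶜ (fun v => d (n + 1) v / D v) ⟨v₀, hv₀⟩
    have hlt (v : V) (hv : v ∈ (U n)ᶜ) : d (n + 1) v < D v := by
      rw [Finset.mem_compl, ← hn, hU] at hv
      exact lt_of_le_of_ne (hle _ v) hv
    have hpos (v : V) (hv : v ∈ (U n)ᶜ) : 0 < D v := (hnonneg _ v).trans_lt (hlt v hv)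
    set θ := d (n + 1) v₁ / D v₁ with hθ
    have hθ0 : 0 ≤ θ := div_nonneg (hnonneg _ _) (hpos v₁ hv₁).le
    have hθ1 : θ < 1 := (div_lt_one (hpos v₁ hv₁)).2 (hlt v₁ hv₁)
    have hθle (v : V) (hv : v ∈ (U n)ᶜ) : d (n + 1) v ≤ θ * D v :=
      (div_le_iff₀ (hpos v hv)).1 (hmax v hv)
    have hDedge (v u : V) (ρ : ℝ) (hu : E v u ρ) : ρ * D u ≤ D v := by
      rw [mul_comm, ← le_div_iff₀ (hE _ _ _ hu)]
      refine ciSup_le fun k => ?_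
      rw [le_div_iff₀ (hE _ _ _ hu), mul_comm]
      exact (h.edge_le k v u ρ hu).trans (hle _ v)
    have hall (k : ℕ) : ∀ v ∈ (U n)ᶜ, d k v ≤ θ * D v := by
      induction k with
      | zero =>
        intro v hv
        rw [h.zero]
        exact (h.init_le n v).trans (hθle v hv)
      | succ k ih =>
        intro v hv
        rcases h.eq_or k v with e | ⟨u, ρ, hu, e⟩
        · rw [e]
          exact (h.init_le n v).trans (hθle v hv)
        · rw [e]
          have hρ := (hE _ _ _ hu).le
          by_cases hun : u ∈ U n
          · calc ρ * d k u ≤ ρ * D u := mul_le_mul_of_nonneg_left (hle k u) hρ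
              _ = ρ * d n u := by rw [(hU n u).1 hun]
              _ ≤ d (n + 1) v := h.edge_le n v u ρ hu
              _ ≤ θ * D v := hθle v hv
          · calc ρ * d k u ≤ ρ * (θ * D u) :=
                  mul_le_mul_of_nonneg_left (ih u (Finset.mem_compl.2 hun)) hρ
              _ = θ * (ρ * D u) := by ring
              _ ≤ θ * D v := mul_le_mul_of_nonneg_left (hDedge v u ρ hu) hθ0
    have hfin : D v₀ ≤ θ * D v₀ := ciSup_le fun k => hall k v₀ hv₀
    have := mul_lt_mul_of_pos_right hθ1 (hpos v₀ hv₀)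
    linarith
  have hstab : U (Fintype.card V + 1) = U (Fintype.card V) :=
    Finset.eq_of_stable hUmono (fun n hn => by
      have h1 := huniv n hn
      have h2 : U (n + 1) = Finset.univ := hn.trans h1
      exact (Finset.eq_univ_of_forall fun v =>
        hUmono (Nat.le_succ (n + 1)) (h2 ▸ Finset.mem_univ v)).trans h2.symm) (Nat.le_succ _)
  have hv : v ∈ U (Fintype.card V) := huniv _ hstab ▸ Finset.mem_univ v
  exact (hle n v).trans ((hU _ v).1 hv).ge

/-- If the maximal weights do not grow from `N` to `N + 1` at the vertices in a set that is closed
under the edges, then they do not grow any more at these vertices. -/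
theorem le_of_stable (h : IsMaxWeight E init d) (hE : ∀ v u ρ, E v u ρ → 0 < ρ) {P : V → Prop}
    (hP : ∀ v u ρ, E v u ρ → P v → P u) {N : ℕ} (hN : ∀ v, P v → d (N + 1) v ≤ d N v) (n : ℕ) :
    ∀ v, P v → d n v ≤ d N v := by
  induction n with
  | zero => intro v _; exact h.mono hE v (Nat.zero_le N)
  | succ n ih =>
    intro v hv
    rcases h.eq_or n v with e | ⟨u, ρ, hu, e⟩
    · rw [e]
      exact (h.init_le N v).trans (hN v hv)
    · rw [e]
      exact ((mul_le_mul_of_nonneg_left (ih u (hP _ _ _ hu hv)) (hE _ _ _ hu).le).trans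
        (h.edge_le N v u ρ hu)).trans (hN v hv)

end IsMaxWeight

end stabilisation

/-! ### Inclusion of the supports -/

namespace WeightedAutomaton

section step

variable {Q S : Type} (A : WeightedAutomaton Q S)

/-- There are transitions with letter `a` between the first components and between the second
components of two pairs of states. -/
def BothStep (a : S) (v u : Q × Q) : Prop := 0 < A.weight a v.1 u.1 ∧ 0 < A.weight a v.2 u.2

instance (a : S) (v u : Q × Q) : Decidable (A.BothStep a v u) := by
  unfold BothStep
  infer_instance

end step

section support

variable {Q S : Type} [Fintype Q] [DecidableEq Q] [Fintype S] (A : WeightedAutomaton Q S)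

/-- The sum of `f` over all words of length `n`. -/
def wordSum : ℕ → (List S → ℕ) → ℕ
  | 0, f => f []
  | n + 1, f => ∑ a, wordSum n fun w => f (a :: w)

theorem wordSum_sum {ι : Type} (s : Finset ι) (n : ℕ) (f : ι → List S → ℕ) :
    wordSum n (fun w => ∑ i ∈ s, f i w) = ∑ i ∈ s, wordSum n (f i) := by
  induction n generalizing f with
  | zero => rfl
  | succ n ih =>
    simp only [wordSum, ih]
    exact Finset.sum_comm

theorem wordSum_ite (p : Prop) [Decidable p] (n : ℕ) (f : List S → ℕ) :
    wordSum n (fun w => if p then f w else 0) = if p then wordSum n f else 0 := by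
  induction n generalizing f with
  | zero => rfl
  | succ n ih => simp only [wordSum, ih]; split <;> simp

theorem wordSum_mono {f g : List S → ℕ} (h : ∀ w, f w ≤ g w) (n : ℕ) :
    wordSum n f ≤ wordSum n g := by
  induction n generalizing f g with
  | zero => exact h []
  | succ n ih => exact Finset.sum_le_sum fun a _ => ih fun w => h (a :: w)

theorem eq_of_wordSum_eq {f g : List S → ℕ} (h : ∀ w, f w ≤ g w) (w : List S)
    (hw : wordSum w.length f = wordSum w.length g) : f w = g w := by
  induction w generalizing f g with
  | nil => exact hw
  | cons a w ih =>
    refine ih (fun w => h (a :: w)) ?_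
    exact (Finset.sum_eq_sum_iff_of_le fun a _ => wordSum_mono (fun w => h (a :: w)) _).1 hw a
      (Finset.mem_univ a)

/-- The number of pairs of accepting paths with the same label, of length `n`. -/
def pairCount (n : ℕ) (v : Q × Q) : ℕ :=
  wordSum n fun w => A.pathCount v.1 w * A.pathCount v.2 w

theorem pairCount_zero (v : Q × Q) :
    A.pairCount 0 v = if v.1 ∈ A.final ∧ v.2 ∈ A.final then 1 else 0 := by
  simp only [pairCount, wordSum, pathCount]
  split_ifs <;> simp_all

theorem pairCount_succ (n : ℕ) (v : Q × Q) : A.pairCount (n + 1) v =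
    ∑ a, ∑ u, if A.BothStep a v u then A.pairCount n u else 0 := by
  rw [pairCount, wordSum]
  refine Finset.sum_congr rfl fun a _ => ?_
  simp only [pairCount, ← wordSum_ite, ← wordSum_sum]
  congr 1
  funext w
  rw [pathCount, pathCount, Finset.sum_mul_sum, Fintype.sum_prod_type]
  refine Finset.sum_congr rfl fun r _ => Finset.sum_congr rfl fun r' _ => ?_
  by_cases h₁ : 0 < A.weight a v.1 r <;> by_cases h₂ : 0 < A.weight a v.2 r' <;>
    simp [BothStep, h₁, h₂]

/-- The adjacency matrix of the product automaton. -/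
def prodMatrix : Matrix (Q × Q) (Q × Q) ℚ := fun v u => ∑ a, if A.BothStep a v u then 1 else 0

theorem pairCount_eq (n : ℕ) (v : Q × Q) : (A.pairCount n v : ℚ) =
    ((A.prodMatrix ^ n).mulVec fun v => (A.pairCount 0 v : ℚ)) v := by
  induction n generalizing v with
  | zero => simp
  | succ n ih =>
    rw [pow_succ', ← Matrix.mulVec_mulVec, pairCount_succ, Matrix.mulVec, dotProduct,
      Finset.sum_comm]
    push_cast
    refine Finset.sum_congr rfl fun u _ => ?_
    rw [← ih, prodMatrix, Finset.sum_mul]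
    exact Finset.sum_congr rfl fun a _ => by split <;> simp

variable {A}

/-- For states from which the automaton is unambiguous, inclusion of the supports can be decided by
counting: a pair of accepting paths with label `w` from `s` and `s'` is unique, and it exists if
and only if `w` is in both supports. It suffices to consider the words whose length is at most
the number of pairs of states. -/
theorem support_subset_iff {s s' : Q} (hs : A.Unambiguous s) (hs' : A.Unambiguous s')
    {C : ℕ → Q × Q → ℕ} (h0 : ∀ v, C 0 v = A.pairCount 0 v)
    (h1 : ∀ n v, C (n + 1) v =
      A.pairCount 0 v + ∑ a, ∑ u, if A.BothStep a v u then C n u else 0) :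
    C (Fintype.card (Q × Q)) (s, s) ≤ C (Fintype.card (Q × Q)) (s, s') ↔
      ∀ w, 0 < A.wordWeight s w → 0 < A.wordWeight s' w := by
  have hC (n : ℕ) (v : Q × Q) : C n v = ∑ i ∈ Finset.range (n + 1), A.pairCount i v := by
    induction n generalizing v with
    | zero => simp [h0]
    | succ n ih =>
      rw [h1, Finset.sum_range_succ', Nat.add_comm]
      congr 1
      simp only [pairCount_succ, ih]
      refine Eq.trans (Finset.sum_congr rfl fun a _ => ?_) Finset.sum_comm
      refine Eq.trans (Finset.sum_congr rfl fun u _ => ?_) Finset.sum_comm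
      split <;> simp
  have hle (w : List S) :
      A.pathCount s w * A.pathCount s' w ≤ A.pathCount s w * A.pathCount s w := by
    have h₁ := hs w
    have h₂ := hs' w
    interval_cases A.pathCount s w <;> simp [h₂]
  have hsub : (∀ w, 0 < A.wordWeight s w → 0 < A.wordWeight s' w) ↔
      ∀ w, A.pathCount s w * A.pathCount s' w = A.pathCount s w * A.pathCount s w := by
    refine forall_congr' fun w => ?_
    rw [← pathCount_pos, ← pathCount_pos]
    have h₁ := hs w
    have h₂ := hs' w
    interval_cases A.pathCount s w <;> interval_cases A.pathCount s' w <;> simp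
  rw [hsub, hC, hC]
  constructor
  · intro h w
    have hi : ∀ i ∈ Finset.range (Fintype.card (Q × Q) + 1),
        A.pairCount i (s, s') = A.pairCount i (s, s) :=
      (Finset.sum_eq_sum_iff_of_le fun i _ => wordSum_mono hle i).1
        (le_antisymm (Finset.sum_le_sum fun i _ => wordSum_mono hle i) h)
    have hall (i : ℕ) : A.pairCount i (s, s') = A.pairCount i (s, s) := by
      have := Matrix.dotProduct_pow_mulVec_eq_zero A.prodMatrix
        (Pi.single (s, s') 1 - Pi.single (s, s) 1) (fun v => (A.pairCount 0 v : ℚ))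
        (fun i hi' => ?_) i
      · rw [sub_dotProduct, single_one_dotProduct, single_one_dotProduct, ← pairCount_eq,
          ← pairCount_eq, sub_eq_zero] at this
        exact_mod_cast this
      · rw [sub_dotProduct, single_one_dotProduct, single_one_dotProduct, ← pairCount_eq,
          ← pairCount_eq, hi i (by rw [Finset.mem_range]; omega), sub_self]
    exact eq_of_wordSum_eq hle w (hall _)
  · intro h
    refine Finset.sum_le_sum fun i _ => le_of_eq ?_
    simp only [pairCount]
    congr 1
    funext w
    exact (h w).symm

end support

/-! ### The criterion for big-O -/

section criterion

variable {Q S : Type} (A : WeightedAutomaton Q S)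

/-- There is an edge of weight `ρ` between two pairs of states in the product automaton. -/
def ProdEdge (v u : Q × Q) (ρ : ℝ) : Prop :=
  ∃ a, A.BothStep a v u ∧ ρ = (A.weight a v.1 u.1 : ℝ) / (A.weight a v.2 u.2 : ℝ)

/-- Reachability in the product automaton. -/
def ProdReach : Q × Q → Q × Q → Prop := Relation.ReflTransGen fun v u => ∃ a, A.BothStep a v u

/-- The weight `1` for pairs of final states, and `0` for all other pairs. -/
def finalWeight [DecidableEq Q] (v : Q × Q) : ℝ := if v.1 ∈ A.final ∧ v.2 ∈ A.final then 1 else 0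

variable {A}

theorem ProdEdge.pos {v u : Q × Q} {ρ : ℝ} (h : A.ProdEdge v u ρ) : 0 < ρ := by
  obtain ⟨a, ⟨h₁, h₂⟩, rfl⟩ := h
  have h₁' : (0 : ℝ) < A.weight a v.1 u.1 := by exact_mod_cast h₁
  have h₂' : (0 : ℝ) < A.weight a v.2 u.2 := by exact_mod_cast h₂
  positivity

variable [Fintype Q] [DecidableEq Q]

/-- Every maximal path weight of the product automaton, unless it is zero, is a lower bound for the
quotient of the weights of some word. -/
theorem exists_word {d : ℕ → Q × Q → ℝ} (hd : IsMaxWeight A.ProdEdge A.finalWeight d) (n : ℕ)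
    {v : Q × Q} (hv : A.Unambiguous v.2) : d n v = 0 ∨
      ∃ w, 0 < A.wordWeight v.2 w ∧ d n v * A.wordWeight v.2 w ≤ A.wordWeight v.1 w := by
  have hinit (v : Q × Q) : A.finalWeight v = 0 ∨ ∃ w, 0 < A.wordWeight v.2 w ∧
      A.finalWeight v * A.wordWeight v.2 w ≤ A.wordWeight v.1 w := by
    by_cases h : v.1 ∈ A.final ∧ v.2 ∈ A.final
    · refine .inr ⟨[], ?_⟩
      simp [wordWeight_nil, finalWeight, h]
    · exact .inl (if_neg h)
  induction n generalizing v with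
  | zero => rw [hd.zero]; exact hinit v
  | succ n ih =>
    rcases hd.eq_or n v with e | ⟨u, ρ, ⟨a, ⟨h₁, h₂⟩, rfl⟩, e⟩
    · rw [e]; exact hinit v
    · rcases ih (hv.of_weight_pos h₂) with h | ⟨w, hw, hle⟩
      · left; rw [e, h, mul_zero]
      · right
        refine ⟨a :: w, ?_, ?_⟩
        · rw [hv.wordWeight_cons h₂ hw]
          positivity
        · rw [e, hv.wordWeight_cons h₂ hw]
          have h₃ : ((A.weight a v.1 u.1 * A.wordWeight u.1 w : ℚ) : ℝ) ≤
              A.wordWeight v.1 (a :: w) := by exact_mod_cast A.le_wordWeight_cons v.1 u.1 a w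
          have h₁' : (0 : ℝ) < A.weight a v.1 u.1 := by exact_mod_cast h₁
          have h₂' : (0 : ℝ) < A.weight a v.2 u.2 := by exact_mod_cast h₂
          refine le_trans ?_ h₃
          push_cast
          calc _ = (A.weight a v.1 u.1 : ℝ) * (d n u * A.wordWeight u.2 w) := by
                field_simp
            _ ≤ _ := mul_le_mul_of_nonneg_left hle h₁'.le

/-- The maximal path weights of the product automaton bound the quotients of the weights of
words. -/
theorem wordWeight_le {d : ℕ → Q × Q → ℝ} (hd : IsMaxWeight A.ProdEdge A.finalWeight d)
    (w : List S) {v : Q × Q} (hv : A.Unambiguous v.1) (h₁ : 0 < A.wordWeight v.1 w)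
    (h₂ : 0 < A.wordWeight v.2 w) :
    (A.wordWeight v.1 w : ℝ) ≤ d w.length v * A.wordWeight v.2 w := by
  induction w generalizing v with
  | nil =>
    have hd0 := hd.zero v
    rw [wordWeight_nil] at h₁ h₂
    split at h₁
    · split at h₂
      · simp_all [finalWeight, wordWeight_nil]
      · simp at h₂
    · simp at h₁
  | cons a w ih =>
    have hex {q : Q} (h : 0 < A.wordWeight q (a :: w)) :
        ∃ r, 0 < A.weight a q r ∧ 0 < A.wordWeight r w := by
      rw [A.wordWeight_cons, Finset.sum_pos_iff_of_nonneg fun r _ =>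
        mul_nonneg (A.weight_nonneg a q r) (A.wordWeight_nonneg r w)] at h
      obtain ⟨r, -, hr⟩ := h
      exact ⟨r, (pos_and_pos_or_neg_and_neg_of_mul_pos hr).resolve_right fun h =>
        (A.weight_nonneg a q r).not_gt h.1⟩
    obtain ⟨r, hr, hrw⟩ := hex h₁
    obtain ⟨r', hr', hrw'⟩ := hex h₂
    have hr₁ : (0 : ℝ) < A.weight a v.1 r := by exact_mod_cast hr
    have hr₂ : (0 : ℝ) < A.weight a v.2 r' := by exact_mod_cast hr'
    have hw₂ : (0 : ℝ) < A.wordWeight r' w := by exact_mod_cast hrw'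
    have ih' := ih (v := (r, r')) (hv.of_weight_pos hr) hrw hrw'
    have hedge := hd.edge_le w.length v (r, r') _ ⟨a, ⟨hr, hr'⟩, rfl⟩
    have hle : ((A.weight a v.2 r' * A.wordWeight r' w : ℚ) : ℝ) ≤ A.wordWeight v.2 (a :: w) := by
      exact_mod_cast A.le_wordWeight_cons v.2 r' a w
    have hdpos : 0 ≤ d (w.length + 1) v := by
      refine le_trans ?_ (hd.init_le w.length v)
      unfold finalWeight
      split <;> simp
    rw [hv.wordWeight_cons hr hrw, List.length_cons]
    push_cast at hle ⊢
    calc (A.weight a v.1 r : ℝ) * A.wordWeight r w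
        ≤ A.weight a v.1 r * (d w.length (r, r') * A.wordWeight r' w) :=
          mul_le_mul_of_nonneg_left ih' hr₁.le
      _ = A.weight a v.1 r / A.weight a v.2 r' * d w.length (r, r') *
            (A.weight a v.2 r' * A.wordWeight r' w) := by field_simp
      _ ≤ d (w.length + 1) v * (A.weight a v.2 r' * A.wordWeight r' w) :=
          mul_le_mul_of_nonneg_right hedge (by positivity)
      _ ≤ _ := mul_le_mul_of_nonneg_left hle hdpos

/-- The quotients of word weights are bounded at all reachable pairs of states if they are bounded
at the initial pair. -/
theorem bounded_of_reach {s s' : Q} (hs : A.Unambiguous s) (hs' : A.Unambiguous s')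
    (h : A.IsBigO s s') {v : Q × Q} (hv : A.ProdReach (s, s') v) :
    A.Unambiguous v.1 ∧ A.Unambiguous v.2 ∧ ∃ C : ℝ, ∀ w, 0 < A.wordWeight v.2 w →
      (A.wordWeight v.1 w : ℝ) ≤ C * A.wordWeight v.2 w := by
  induction hv with
  | refl =>
    obtain ⟨C, -, hC⟩ := h
    exact ⟨hs, hs', C, fun w _ => hC w⟩
  | @tail v u _ hu ih =>
    obtain ⟨h₁, h₂, C, hC⟩ := ih
    obtain ⟨a, hr, hr'⟩ := hu
    refine ⟨h₁.of_weight_pos hr, h₂.of_weight_pos hr', C * A.weight a v.2 u.2 / A.weight a v.1 u.1,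
      fun w hw => ?_⟩
    have hle : ((A.weight a v.1 u.1 * A.wordWeight u.1 w : ℚ) : ℝ) ≤ A.wordWeight v.1 (a :: w) := by
      exact_mod_cast A.le_wordWeight_cons v.1 u.1 a w
    have hr₁ : (0 : ℝ) < A.weight a v.1 u.1 := by exact_mod_cast hr
    have := hC (a :: w) (by rw [h₂.wordWeight_cons hr' hw]; positivity)
    rw [h₂.wordWeight_cons hr' hw] at this
    push_cast at hle this
    rw [div_mul_eq_mul_div, le_div_iff₀ hr₁]
    linarith

/-- For states from which the automaton is unambiguous, `s` is big-O of `s'` if and only if the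
support of `s` is contained in that of `s'` and the maximal weights of accepting paths in the
product automaton become stable at the reachable vertices. -/
theorem isBigO_iff {s s' : Q} (hs : A.Unambiguous s) (hs' : A.Unambiguous s') {d : ℕ → Q × Q → ℝ}
    (hd : IsMaxWeight A.ProdEdge A.finalWeight d) : A.IsBigO s s' ↔
      (∀ w, 0 < A.wordWeight s w → 0 < A.wordWeight s' w) ∧
      ∀ v, A.ProdReach (s, s') v →
        d (Fintype.card (Q × Q) + 1) v ≤ d (Fintype.card (Q × Q)) v := by
  classical
  have hE : ∀ v u ρ, A.ProdEdge v u ρ → 0 < ρ := fun v u ρ h => h.pos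
  have hmono := hd.mono hE
  have hinit (v : Q × Q) : 0 ≤ A.finalWeight v := by unfold finalWeight; split <;> simp
  constructor
  · intro h
    refine ⟨fun w hw => ?_, fun v hv => ?_⟩
    · obtain ⟨C, hC, hCw⟩ := h
      refine lt_of_le_of_ne (A.wordWeight_nonneg s' w) fun h0 => ?_
      have := hCw w
      rw [← h0] at this
      simp only [Rat.cast_zero, mul_zero] at this
      exact absurd (by exact_mod_cast this) (not_le.2 hw)
    · let V := {v // A.ProdReach (s, s') v}
      have hdV : IsMaxWeight (V := V) (fun v u ρ => A.ProdEdge v.1 u.1 ρ)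
          (fun v => A.finalWeight v.1) (fun n v => d n v.1) := by
        refine ⟨fun v => hd.zero v, fun n v => hd.init_le n v, fun n v u => hd.edge_le n v u,
          fun n v => ?_⟩
        refine (hd.eq_or n v.1).imp_right ?_
        rintro ⟨u, ρ, ⟨a, hu, e⟩, h'⟩
        exact ⟨⟨u, v.2.tail ⟨a, hu⟩⟩, ρ, ⟨a, hu, e⟩, h'⟩
      have := hdV.stable (fun v u ρ h => h.pos) (fun v => hinit v.1) (fun v => ?_)
        (Fintype.card (Q × Q) + 1) ⟨v, hv⟩
      · exact this.trans (hmono v (Fintype.card_subtype_le _))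
      · obtain ⟨-, h₂, C, hC⟩ := bounded_of_reach hs hs' h v.2
        refine ⟨max C 0, fun n => ?_⟩
        rcases exists_word hd n h₂ with e | ⟨w, hw, hle⟩
        · rw [e]; exact le_max_right _ _
        · have hw' : (0 : ℝ) < A.wordWeight v.1.2 w := by exact_mod_cast hw
          exact (le_of_mul_le_mul_right (hle.trans (hC w hw)) hw').trans (le_max_left _ _)
  · rintro ⟨hsub, hstab⟩
    have hbound := hd.le_of_stable hE (P := A.ProdReach (s, s'))
      (fun v u ρ hu hv => hv.tail (hu.imp fun _ h => h.1)) hstab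
    have h0 : 0 ≤ d (Fintype.card (Q × Q)) (s, s') :=
      ((hinit _).trans (hd.zero _).ge).trans (hmono _ (Nat.zero_le _))
    refine ⟨d (Fintype.card (Q × Q)) (s, s') + 1, by positivity, fun w => ?_⟩
    have hw' : (0 : ℝ) ≤ A.wordWeight s' w := by exact_mod_cast A.wordWeight_nonneg s' w
    rcases (A.wordWeight_nonneg s w).eq_or_lt with h | h
    · rw [← h]
      push_cast
      positivity
    · calc (A.wordWeight s w : ℝ) ≤ d w.length (s, s') * A.wordWeight s' w :=
            wordWeight_le hd w (v := (s, s')) hs h (hsub w h)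
        _ ≤ _ := mul_le_mul_of_nonneg_right
            ((hbound w.length _ .refl).trans (by simp)) hw'

end criterion

end WeightedAutomaton

namespace PolyTime

/-! ### Meaning of the path sums -/

theorem bitVal_encodePosNum (n : PosNum) : bitVal (Computability.encodePosNum n) = (n : ℕ) := by
  induction n with
  | one => rfl
  | bit0 n ih => simp [Computability.encodePosNum, bitVal, ih, PosNum.cast_bit0]; omega
  | bit1 n ih => simp [Computability.encodePosNum, bitVal, ih, PosNum.cast_bit1]; omega

theorem bitVal_encodeNat (n : ℕ) : bitVal (Computability.encodeNat n) = n := by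
  conv_rhs => rw [← Num.to_of_nat n]
  rw [Computability.encodeNat]
  cases (n : Num) with
  | zero => rfl
  | pos p => exact bitVal_encodePosNum p

theorem isEmpty_encodeNat (n : ℕ) : (Computability.encodeNat n).isEmpty = false ↔ 0 < n := by
  constructor
  · intro h
    by_contra h0
    obtain rfl : n = 0 := by omega
    revert h
    decide
  · intro h
    rw [List.isEmpty_eq_false_iff]
    intro h0
    have := bitVal_encodeNat n
    rw [h0] at this
    simp [bitVal] at this
    omega

theorem bitVal_relax (E : List (Edge (List Bool × List Bool))) (x : List Bool)
    (f : Vtx → List Bool) (v : Vtx) : bitVal (countArith.relax E x f v) =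
      bitVal x + (E.map fun e => if e.1.1 = v then bitVal (f e.1.2) else 0).sum := by
  induction E generalizing x with
  | nil => rfl
  | cons e E ih =>
    have h : countArith.relax (e :: E) x f v =
      countArith.relax E (bif e.1.1 == v then addBits x (f e.1.2) else x) f v := rfl
    rw [h, ih, List.map_cons, List.sum_cons, ← add_assoc]
    congr 1
    by_cases hv : e.1.1 = v
    · simp [hv, bitVal_addBits]
    · rw [beq_false_of_ne hv, cond_false, if_neg hv, add_zero]

/-- The value of a fraction. -/
noncomputable def fracVal (x : List Bool × List Bool) : ℝ := (bitVal x.1 : ℝ) / (bitVal x.2 : ℝ)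

theorem leFrac_iff {x y : List Bool × List Bool} (hx : 0 < bitVal x.2) (hy : 0 < bitVal y.2) :
    leFrac x y = true ↔ fracVal x ≤ fracVal y := by
  have hx' : (0 : ℝ) < bitVal x.2 := by exact_mod_cast hx
  have hy' : (0 : ℝ) < bitVal y.2 := by exact_mod_cast hy
  rw [leFrac, leBits_iff, bitVal_mulBits, bitVal_mulBits, fracVal, fracVal,
    div_le_div_iff₀ hx' hy']
  norm_cast

theorem fracVal_mul (w x : List Bool × List Bool) :
    fracVal (maxArith.mul w x) = fracVal w * fracVal x := by
  simp only [fracVal, maxArith, bitVal_mulBits]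
  push_cast
  rw [mul_div_mul_comm]

/-- In the arithmetic of maxima, a relaxation step computes the maximum of `x` and of the
contributions of the edges from `v`. -/
theorem relax_maxArith {E : List (Edge (List Bool × List Bool))} {x : List Bool × List Bool}
    {f : Vtx → List Bool × List Bool} {v : Vtx} (hE : ∀ e ∈ E, 0 < bitVal e.2.2)
    (hx : 0 < bitVal x.2) (hf : ∀ u, 0 < bitVal (f u).2) :
    0 < bitVal (maxArith.relax E x f v).2 ∧ fracVal x ≤ fracVal (maxArith.relax E x f v) ∧
    (∀ e ∈ E, e.1.1 = v → fracVal e.2 * fracVal (f e.1.2) ≤ fracVal (maxArith.relax E x f v)) ∧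
    (fracVal (maxArith.relax E x f v) = fracVal x ∨ ∃ e ∈ E, e.1.1 = v ∧
      fracVal (maxArith.relax E x f v) = fracVal e.2 * fracVal (f e.1.2)) := by
  induction E using List.reverseRecOn with
  | nil => exact ⟨hx, le_rfl, by simp, .inl rfl⟩
  | append_singleton E e ih =>
    obtain ⟨h₁, h₂, h₃, h₄⟩ := ih fun e he => hE e (by simp [he])
    have h : maxArith.relax (E ++ [e]) x f v = bif e.1.1 == v then
        maxArith.add (maxArith.relax E x f v) (maxArith.mul e.2 (f e.1.2))
        else maxArith.relax E x f v := by
      simp [Arith.relax, List.foldl_append]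
    have h₄' : (fracVal (maxArith.relax E x f v) = fracVal x ∨ ∃ e' ∈ E ++ [e], e'.1.1 = v ∧
        fracVal (maxArith.relax E x f v) = fracVal e'.2 * fracVal (f e'.1.2)) :=
      h₄.imp_right fun ⟨e', he', h⟩ => ⟨e', by simp [he'], h⟩
    by_cases hv : e.1.1 = v
    · have hpos : 0 < bitVal (maxArith.mul e.2 (f e.1.2)).2 := by
        simp only [maxArith, bitVal_mulBits]
        exact Nat.mul_pos (hE e (by simp)) (hf _)
      have hadd : maxArith.relax (E ++ [e]) x f v =
          bif leFrac (maxArith.relax E x f v) (maxArith.mul e.2 (f e.1.2)) then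
            maxArith.mul e.2 (f e.1.2) else maxArith.relax E x f v := by
        rw [h, beq_iff_eq.2 hv, cond_true]
        rfl
      have hle := leFrac_iff h₁ hpos
      rw [hadd]
      cases hc : leFrac (maxArith.relax E x f v) (maxArith.mul e.2 (f e.1.2)) with
      | true =>
        have hle' := hle.1 hc
        simp only [cond_true]
        refine ⟨hpos, h₂.trans hle', fun e' he' hv' => ?_,
          .inr ⟨e, by simp, hv, fracVal_mul _ _⟩⟩
        rcases List.mem_append.1 he' with he' | he'
        · exact (h₃ e' he' hv').trans hle'
        · obtain rfl := List.mem_singleton.1 he'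
          exact (fracVal_mul _ _).ge
      | false =>
        have hle' : fracVal (maxArith.mul e.2 (f e.1.2)) ≤ fracVal (maxArith.relax E x f v) := by
          refine le_of_not_ge fun h => ?_
          rw [hle.2 h] at hc
          exact absurd hc (by decide)
        simp only [cond_false]
        refine ⟨h₁, h₂, fun e' he' hv' => ?_, h₄'⟩
        rcases List.mem_append.1 he' with he' | he'
        · exact h₃ e' he' hv'
        · obtain rfl := List.mem_singleton.1 he'
          exact (fracVal_mul _ _).ge.trans hle'
    · rw [h, beq_false_of_ne hv, cond_false]
      refine ⟨h₁, h₂, fun e' he' hv' => ?_, h₄'⟩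
      rcases List.mem_append.1 he' with he' | he'
      · exact h₃ e' he' hv'
      · obtain rfl := List.mem_singleton.1 he'
        exact absurd hv' hv

/-! ### Correctness of the decision procedure -/

section correctness

variable (I : BigOInput)

/-- A pair of states of the input as a vertex. -/
def vtx (v : Fin I.numStates × Fin I.numStates) : Vtx := (v.1, v.2)

theorem vtx_injective : Function.Injective (vtx I) := by
  rintro ⟨q, r⟩ ⟨q', r'⟩ h
  simpa [vtx, Fin.ext_iff] using h

theorem mem_vertices {m : ℕ} {v : Vtx} : v ∈ vertices m ↔ v.1 < m ∧ v.2 < m := by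
  obtain ⟨q, r⟩ := v
  simp [vertices]

theorem length_vertices (m : ℕ) : (vertices m).length = Fintype.card (Fin m × Fin m) := by
  simp [vertices]

theorem vtx_mem_vertices (v : Fin I.numStates × Fin I.numStates) :
    vtx I v ∈ vertices I.numStates :=
  mem_vertices.2 ⟨v.1.2, v.2.2⟩

theorem exists_vtx {v : Vtx} (hv : v ∈ vertices I.numStates) : ∃ u, vtx I u = v :=
  ⟨(⟨v.1, (mem_vertices.1 hv).1⟩, ⟨v.2, (mem_vertices.1 hv).2⟩), rfl⟩

/-- The edges of the product automaton of the input. -/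
def inputEdges : List (Edge (List Bool × List Bool)) :=
  prodEdges ((finTriples I).map (transition I))

/-- The edge of the product automaton for a letter and two pairs of states. -/
def inputEdge (a : Fin I.numLetters) (v u : Fin I.numStates × Fin I.numStates) :
    Edge (List Bool × List Bool) :=
  prodEdge (transition I (a, v.1, u.1)) (transition I (a, v.2, u.2))

theorem weight_pos_iff (a : Fin I.numLetters) (q r : Fin I.numStates) :
    0 < I.automaton.weight a q r ↔ 0 < I.num a q r := by
  have hd : (0 : ℚ) < I.den a q r := by exact_mod_cast I.den_pos a q r
  change 0 < (I.num a q r : ℚ) / (I.den a q r : ℚ) ↔ _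
  rw [div_pos_iff_of_pos_right hd]
  norm_cast

theorem compatible_iff (a a' : Fin I.numLetters) (v u : Fin I.numStates × Fin I.numStates) :
    compatible (transition I (a, v.1, u.1)) (transition I (a', v.2, u.2)) = true ↔
      a = a' ∧ I.automaton.BothStep a v u := by
  simp only [compatible, transition, Bool.and_eq_true, beq_iff_eq, Bool.not_eq_true',
    isEmpty_encodeNat, ← Fin.ext_iff, WeightedAutomaton.BothStep, weight_pos_iff, and_assoc]
  refine and_congr_right ?_
  rintro rfl
  rfl

theorem sum_map_flatMap {α β : Type} (l : List α) (f : α → List β) (g : β → ℕ) :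
    ((l.flatMap f).map g).sum = (l.map fun x => ((f x).map g).sum).sum := by
  induction l with
  | nil => rfl
  | cons x l ih => simp [ih]

theorem sum_map_finRange {n : ℕ} (g : Fin n → ℕ) : ((List.finRange n).map g).sum = ∑ i, g i := by
  rw [Fin.sum_univ_def]

theorem sum_finTriples (g : Fin I.numLetters × Fin I.numStates × Fin I.numStates → ℕ) :
    ((finTriples I).map g).sum = ∑ a, ∑ q, ∑ r, g (a, q, r) := by
  simp only [finTriples, sum_map_flatMap, List.map_map, Function.comp_def, sum_map_finRange]

theorem sum_map_filter {α : Type} (l : List α) (p : α → Bool) (g : α → ℕ) :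
    ((l.filter p).map g).sum = (l.map fun x => if p x = true then g x else 0).sum := by
  induction l with
  | nil => rfl
  | cons x l ih => cases h : p x <;> simp [h, ih]

theorem sum_inputEdges (g : Edge (List Bool × List Bool) → ℕ) : ((inputEdges I).map g).sum =
    ∑ a, ∑ v, ∑ u, if I.automaton.BothStep a v u then g (inputEdge I a v u) else 0 := by
  simp only [inputEdges, prodEdges, sum_map_flatMap, List.map_map, Function.comp_def,
    sum_map_filter, sum_finTriples]
  refine Finset.sum_congr rfl fun a _ => ?_
  rw [Fintype.sum_prod_type]
  refine Finset.sum_congr rfl fun q _ => ?_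
  simp only [Fintype.sum_prod_type]
  refine Eq.trans (Finset.sum_congr rfl fun r _ => ?_) Finset.sum_comm
  rw [Finset.sum_eq_single a]
  · refine Finset.sum_congr rfl fun q' _ => Finset.sum_congr rfl fun r' _ => ?_
    have := compatible_iff I a a (q, q') (r, r')
    simp only [true_and] at this
    simp only [this]
    rfl
  · intro a' _ hne
    refine Finset.sum_eq_zero fun q' _ => Finset.sum_eq_zero fun r' _ => if_neg fun h => ?_
    exact hne ((compatible_iff I a a' (q, q') (r, r')).1 h).1.symm
  · simp

theorem mem_inputEdges {e : Edge (List Bool × List Bool)} : e ∈ inputEdges I ↔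
    ∃ a v u, I.automaton.BothStep a v u ∧ e = inputEdge I a v u := by
  have hmem (x) : x ∈ finTriples I := by simp [finTriples]
  simp only [inputEdges, prodEdges, List.mem_flatMap, List.mem_map, List.mem_filter]
  constructor
  · rintro ⟨_, ⟨⟨a, q, r⟩, -, rfl⟩, _, ⟨⟨⟨a', q', r'⟩, -, rfl⟩, hc⟩, rfl⟩
    obtain ⟨rfl, h⟩ := (compatible_iff I a a' (q, q') (r, r')).1 hc
    exact ⟨a, (q, q'), (r, r'), h, rfl⟩
  · rintro ⟨a, v, u, h, rfl⟩
    exact ⟨_, ⟨_, hmem _, rfl⟩, _, ⟨⟨_, hmem _, rfl⟩, (compatible_iff I a a v u).2 ⟨rfl, h⟩⟩, rfl⟩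

theorem bothFinal_vtx (rest : List Bool) (v : Fin I.numStates × Fin I.numStates) :
    bothFinal ((List.finRange I.numStates).map (fun q => decide (q ∈ I.final)) ++ rest)
      (vtx I v) = decide (v.1 ∈ I.final ∧ v.2 ∈ I.final) := by
  have h (q : Fin I.numStates) :
      (((List.finRange I.numStates).map (fun q => decide (q ∈ I.final)) ++ rest).drop
        (q : ℕ)).headD false = decide (q ∈ I.final) := by
    rw [List.headD_eq_head?_getD, List.head?_drop, List.getElem?_append_left (by simp)]
    simp
  rw [bothFinal, vtx, h, h, Bool.decide_and]

theorem fracVal_inputEdge (a : Fin I.numLetters) (v u : Fin I.numStates × Fin I.numStates) :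
    fracVal (inputEdge I a v u).2 =
      (I.automaton.weight a v.1 u.1 : ℝ) / (I.automaton.weight a v.2 u.2 : ℝ) := by
  simp only [fracVal, inputEdge, prodEdge, transition, bitVal_mulBits, bitVal_encodeNat,
    BigOInput.automaton]
  push_cast
  rw [div_div_div_eq]

/-- The input as it is seen by the decision procedure. Its list of final states has further entries
`rest`, which are not used. -/
def parsedInput (rest : List Bool) : ParsedInput :=
  ((I.numStates, (I.s : ℕ), (I.s' : ℕ)),
    (List.finRange I.numStates).map (fun q => decide (q ∈ I.final)) ++ rest,
    (finTriples I).map (transition I))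

variable {I} {rest : List Bool}

theorem target_mem_vertices {e : Edge (List Bool × List Bool)} (he : e ∈ inputEdges I) :
    e.1.2 ∈ vertices I.numStates := by
  obtain ⟨a, v, u, -, rfl⟩ := (mem_inputEdges I).1 he
  exact vtx_mem_vertices I u

theorem source_mem_vertices {e : Edge (List Bool × List Bool)} (he : e ∈ inputEdges I) :
    e.1.1 ∈ vertices I.numStates := by
  obtain ⟨a, v, u, -, rfl⟩ := (mem_inputEdges I).1 he
  exact vtx_mem_vertices I v

theorem inclusionTest_iff (hs : I.automaton.Unambiguous I.s)
    (hs' : I.automaton.Unambiguous I.s') : inclusionTest (parsedInput I rest) = true ↔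
      ∀ w, 0 < I.automaton.wordWeight I.s w → 0 < I.automaton.wordWeight I.s' w := by
  set fin := (List.finRange I.numStates).map (fun q => decide (q ∈ I.final)) ++ rest
  let init : Vtx → List Bool := fun v => bif bothFinal fin v then [true] else []
  have hinit (v) : bitVal (init (vtx I v)) = I.automaton.pairCount 0 v := by
    rw [WeightedAutomaton.pairCount_zero]
    simp only [init, fin, bothFinal_vtx]
    by_cases h : v.1 ∈ I.automaton.final ∧ v.2 ∈ I.automaton.final
    · rw [if_pos h, decide_eq_true (p := v.1 ∈ I.final ∧ v.2 ∈ I.final) h]; rfl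
    · rw [if_neg h, decide_eq_false (p := v.1 ∈ I.final ∧ v.2 ∈ I.final) h]; rfl
  have key := WeightedAutomaton.support_subset_iff hs hs'
    (C := fun n v => bitVal (countArith.pathSum (inputEdges I) init n (vtx I v))) hinit
    (fun n v => by
      simp only [Arith.pathSum, bitVal_relax, hinit, sum_inputEdges]
      congr 1
      refine Finset.sum_congr rfl fun a _ => ?_
      rw [Finset.sum_eq_single v]
      · refine Finset.sum_congr rfl fun u _ => ?_
        rw [if_pos (show (inputEdge I a v u).1.1 = vtx I v from rfl)]
        rfl
      · intro v' _ hne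
        refine Finset.sum_eq_zero fun u _ => ?_
        rw [if_neg (fun h => hne (vtx_injective I h) : ¬ (inputEdge I a v' u).1.1 = vtx I v),
          ite_self]
      · simp)
  rw [← key, inclusionTest, leBits_iff]
  have hlookup (v) : lookup [] (countTable (parsedInput I rest)) (vtx I v) =
      countArith.pathSum (inputEdges I) init (Fintype.card (Fin I.numStates × Fin I.numStates))
        (vtx I v) := by
    rw [← length_vertices]
    exact countArith.lookup_table (fun e => target_mem_vertices) init _ (vtx_mem_vertices I v)
  rw [← hlookup, ← hlookup]
  rfl

theorem reachTable_iff (v : Fin I.numStates × Fin I.numStates) :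
    leBits (lookup [] (reachTable (parsedInput I rest)) (vtx I v)) [] = false ↔
      I.automaton.ProdReach (I.s, I.s') v := by
  let flip : Edge (List Bool × List Bool) → Edge (List Bool × List Bool) :=
    fun e => ((e.1.2, e.1.1), e.2)
  let init : Vtx → List Bool := fun v => bif v == ((I.s : ℕ), (I.s' : ℕ)) then [true] else []
  have hinit (v) : 0 < bitVal (init (vtx I v)) ↔ v = (I.s, I.s') := by
    by_cases h : v = (I.s, I.s')
    · subst h
      simp [init, vtx, bitVal]
    · have h' : vtx I v ≠ ((I.s : ℕ), (I.s' : ℕ)) := fun e => h (vtx_injective I e)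
      simp only [init, beq_false_of_ne h', cond_false, bitVal, h, lt_irrefl]
  let C : ℕ → Fin I.numStates × Fin I.numStates → List Bool :=
    fun n v => countArith.pathSum ((inputEdges I).map flip) init n (vtx I v)
  have key := mem_of_reachable (R := fun v u => ∃ a, I.automaton.BothStep a v u) (s := (I.s, I.s'))
    (f := fun n => Finset.univ.filter fun v => 0 < bitVal (C n v)) (fun v => by
      rw [Finset.mem_filter, ← hinit v]
      exact and_iff_right (Finset.mem_univ v))
    (fun n v => by
      simp only [Finset.mem_filter, Finset.mem_univ, true_and, C, Arith.pathSum, bitVal_relax,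
        Nat.add_pos_iff_pos_or_pos, hinit]
      refine or_congr_right ?_
      rw [List.map_map, Nat.pos_iff_ne_zero, ne_eq, List.sum_eq_zero_iff]
      simp only [List.mem_map, Function.comp_apply, not_forall]
      constructor
      · rintro ⟨_, ⟨e, he, rfl⟩, h⟩
        obtain ⟨a, u, v', hstep, rfl⟩ := (mem_inputEdges I).1 he
        by_cases hv : vtx I v' = vtx I v
        · obtain rfl := vtx_injective I hv
          exact ⟨u, Nat.pos_of_ne_zero fun h0 => h ((if_pos hv).trans h0), a, hstep⟩
        · exact absurd (if_neg hv) h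
      · rintro ⟨u, hu, a, hstep⟩
        refine ⟨_, ⟨inputEdge I a u v, (mem_inputEdges I).2 ⟨a, u, v, hstep, rfl⟩, rfl⟩, ?_⟩
        exact fun h0 => hu.ne' ((if_pos rfl).symm.trans h0)) v
  have hlookup : lookup [] (reachTable (parsedInput I rest)) (vtx I v) =
      C (Fintype.card (Fin I.numStates × Fin I.numStates)) v := by
    rw [← length_vertices]
    refine countArith.lookup_table (fun e he => ?_) init _ (vtx_mem_vertices I v)
    obtain ⟨e', he', rfl⟩ := List.mem_map.1 he
    exact source_mem_vertices (I := I) he'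
  rw [WeightedAutomaton.ProdReach, ← key, hlookup, ← Bool.not_eq_true, leBits_iff]
  simp [bitVal]

/-- The weight with which a path may end at a vertex, as a fraction. -/
def finalFrac (I : BigOInput) (rest : List Bool) (v : Vtx) : List Bool × List Bool :=
  bif bothFinal (parsedInput I rest).2.1 v then ([true], [true]) else ([], [true])

/-- The maximal weight of an accepting path of length at most `n`, as a fraction. -/
def maxFrac (I : BigOInput) (rest : List Bool) (n : ℕ) (v : Vtx) : List Bool × List Bool :=
  maxArith.pathSum (inputEdges I) (finalFrac I rest) n v

theorem den_finalFrac_pos (v : Vtx) : 0 < bitVal (finalFrac I rest v).2 := by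
  unfold finalFrac
  cases bothFinal (parsedInput I rest).2.1 v <;> exact Nat.one_pos

theorem den_inputEdges_pos {e : Edge (List Bool × List Bool)} (he : e ∈ inputEdges I) :
    0 < bitVal e.2.2 := by
  obtain ⟨a, v, u, h, rfl⟩ := (mem_inputEdges I).1 he
  simp only [inputEdge, prodEdge, transition, bitVal_mulBits, bitVal_encodeNat]
  exact Nat.mul_pos (I.den_pos _ _ _) ((weight_pos_iff I _ _ _).1 h.2)

theorem den_maxFrac_pos (n : ℕ) (v : Vtx) : 0 < bitVal (maxFrac I rest n v).2 := by
  induction n generalizing v with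
  | zero => exact den_finalFrac_pos v
  | succ n ih => exact (relax_maxArith (fun e => den_inputEdges_pos) (den_finalFrac_pos v) ih).1

theorem isMaxWeight_maxFrac (I : BigOInput) (rest : List Bool) :
    IsMaxWeight I.automaton.ProdEdge I.automaton.finalWeight
      (fun n v => fracVal (maxFrac I rest n (vtx I v))) := by
  have hinit (v) : fracVal (finalFrac I rest (vtx I v)) = I.automaton.finalWeight v := by
    simp only [finalFrac, parsedInput, bothFinal_vtx, WeightedAutomaton.finalWeight]
    by_cases h : v.1 ∈ I.automaton.final ∧ v.2 ∈ I.automaton.final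
    · rw [if_pos h, decide_eq_true (p := v.1 ∈ I.final ∧ v.2 ∈ I.final) h]
      simp [fracVal, bitVal]
    · rw [if_neg h, decide_eq_false (p := v.1 ∈ I.final ∧ v.2 ∈ I.final) h]
      simp [fracVal, bitVal]
  have key (n : ℕ) (v) := relax_maxArith (v := vtx I v) (E := inputEdges I)
    (fun e => den_inputEdges_pos) (den_finalFrac_pos (I := I) (rest := rest) (vtx I v))
    (den_maxFrac_pos (I := I) (rest := rest) n)
  refine ⟨hinit, fun n v => ?_, fun n v u ρ => ?_, fun n v => ?_⟩
  · rw [← hinit]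
    exact (key n v).2.1
  · rintro ⟨a, h, rfl⟩
    rw [← fracVal_inputEdge]
    exact (key n v).2.2.1 _ ((mem_inputEdges I).2 ⟨a, v, u, h, rfl⟩) rfl
  · rw [← hinit]
    refine (key n v).2.2.2.imp_right ?_
    rintro ⟨e, he, hv, h⟩
    obtain ⟨a, v', u, hstep, rfl⟩ := (mem_inputEdges I).1 he
    obtain rfl : v' = v := vtx_injective I hv
    refine ⟨u, _, ⟨a, hstep, rfl⟩, ?_⟩
    rw [← fracVal_inputEdge]
    exact h

theorem stabilityTest_iff : stabilityTest (parsedInput I rest) = true ↔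
    ∀ v, I.automaton.ProdReach (I.s, I.s') v →
      fracVal (maxFrac I rest (Fintype.card (Fin I.numStates × Fin I.numStates) + 1) (vtx I v)) ≤
        fracVal (maxFrac I rest (Fintype.card (Fin I.numStates × Fin I.numStates)) (vtx I v)) := by
  have hlookup (i : ℕ) (v) : lookup maxArith.zero (maxTable (parsedInput I rest) i) (vtx I v) =
      maxFrac I rest (Fintype.card (Fin I.numStates × Fin I.numStates) + i) (vtx I v) := by
    rw [← length_vertices]
    exact maxArith.lookup_table (fun e => target_mem_vertices) _ _ (vtx_mem_vertices I v)
  have htest (v) : (leBits (lookup [] (reachTable (parsedInput I rest)) (vtx I v)) [] ||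
      leFrac (lookup maxArith.zero (maxTable (parsedInput I rest) 1) (vtx I v))
        (lookup maxArith.zero (maxTable (parsedInput I rest) 0) (vtx I v))) = true ↔
      (I.automaton.ProdReach (I.s, I.s') v →
      fracVal (maxFrac I rest (Fintype.card (Fin I.numStates × Fin I.numStates) + 1) (vtx I v)) ≤
        fracVal (maxFrac I rest (Fintype.card (Fin I.numStates × Fin I.numStates)) (vtx I v))) := by
    rw [hlookup, hlookup, Bool.or_eq_true, leFrac_iff (den_maxFrac_pos _ _) (den_maxFrac_pos _ _),
      ← reachTable_iff (rest := rest), ← Bool.not_eq_true, imp_iff_not_or, not_not, add_zero]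
  rw [stabilityTest, List.all_eq_true]
  constructor
  · intro h v
    exact (htest v).1 (h _ (vtx_mem_vertices I v))
  · intro h v hv
    obtain ⟨u, rfl⟩ := exists_vtx I hv
    exact (htest u).2 (h u)

end correctness

end PolyTime

theorem theorem9p1 :
    DecidableInPolyTimeOn BigOInput.encode
      (fun I => I.automaton.UnambiguousFrom I.s ∧ I.automaton.UnambiguousFrom I.s')
      (fun I => I.automaton.IsBigO I.s I.s') := by
  refine PolyTime.decidableInPolyTimeOn_of_decideBigO fun I ⟨hs, hs'⟩ => ?_
  obtain ⟨rest, h⟩ := PolyTime.parse_encode I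
  rw [h, PolyTime.decideBigO, Bool.and_eq_true,
    WeightedAutomaton.isBigO_iff hs.unambiguous hs'.unambiguous
      (PolyTime.isMaxWeight_maxFrac I rest)]
  exact and_congr (PolyTime.inclusionTest_iff hs.unambiguous hs'.unambiguous)
    PolyTime.stabilityTest_iff
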